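/- Let $\mathbb H$ be the hexagonal lattice and write $\mathcal N(x)$ for the three nearest neighbours of a site $x$. Let $\nu$ be a probability measure on $\mathbb R$ with $\nu([0,1))=1$, let $h\ge 2$ and $\lambda\in[0,1]$. Take, independently of each other: i.i.d. couplings $J_{x,y}$ with law $\nu$, one for each nearest-neighbour pair; i.i.d. initial spins $\sigma^0_x\in\{-1,+1\}$ with $P(\sigma^0_x=+1)=\lambda$; and independent rate-$1$ Poisson clocks at the sites, with independent fair coins attached to the rings. Let $\sigma^t$, $t\ge 0$, be the zero-temperature dynamics of the disordered ferromagnet $\mathcal H=-\sum_{\langle x,y\rangle}J_{x,y}\sigma_x\sigma_y-h\sum_x\sigma_x$ driven by this randomness: it is right-continuous and starts from $\sigma^0$; the spin at $x$ does not change while the clock at $x$ does not ring; and when this clock rings, the spin at $x$ is flipped if $$\Delta\mathcal H_x(\sigma)=2\sum_{y\in\mathcal N(x)}J_{x,y}\sigma_x\sigma_y+2h\sigma_x ,$$ evaluated at the configuration just before the ring, is negative, is not flipped if it is positive, and is flipped if and only if the coin of this ring shows heads if it is $0$. Assume that $\lambda>0$ or $\nu([0,h/3])>0$. (The second condition holds,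 for example, for the uniform distribution on $[0,1)$. If both conditions fail then the initial configuration is almost surely all $-1$ and no spin ever flips.) Then, almost surely, such a trajectory $(\sigma^t)_{t\ge0}$ exists, and for every such trajectory $\lim_{t\to\infty}\sigma^t_x=+1$ for all $x\in\mathbb H$. Moreover, there is a constant $c\in(0,\infty)$ such that for all $t\ge 0$ the probability that the spin at the origin flips at some time after $t$ satisfies $$\tilde p(t)\le e^{-ct}.$$ -/

import Mathlib

open MeasureTheory ProbabilityTheory Filter Topology

namespace ZeroTempIsing

/-! ### The hexagonal lattice -/

/-- Sites of the hexagonal lattice: a unit cell in `ℤ × ℤ` and one of the two sublattices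
(`false` or `true`). -/
abbrev Site : Type := ℤ × ℤ × Bool

/-- The three neighbours of a site. The site `(a, b, false)` has the neighbours `(a, b, true)`,
`(a - 1, b, true)`, `(a, b - 1, true)`, and `(a, b, true)` has the neighbours `(a, b, false)`,
`(a + 1, b, false)`, `(a, b + 1, false)`. -/
def nbr : Site → Fin 3 → Site
  | (a, b, false), i => (if i = 1 then a - 1 else a, if i = 2 then b - 1 else b, true)
  | (a, b, true), i => (if i = 1 then a + 1 else a, if i = 2 then b + 1 else b, false)

theorem nbr_nbr (x : Site) (i : Fin 3) : nbr (nbr x i) i = x := by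
  obtain ⟨a, b, c⟩ := x
  cases c <;> fin_cases i <;> simp [nbr]

theorem nbr_ne (x : Site) (i : Fin 3) : nbr x i ≠ x := by
  obtain ⟨a, b, c⟩ := x
  cases c <;> simp [nbr]

/-- The hexagonal lattice as a graph. -/
def hexLattice : SimpleGraph Site where
  Adj x y := ∃ i, nbr x i = y
  symm := ⟨by
    rintro x y ⟨i, rfl⟩
    exact ⟨i, nbr_nbr x i⟩⟩
  loopless := ⟨by
    rintro x ⟨i, hi⟩
    exact nbr_ne x i hi⟩

theorem adj_nbr (x : Site) (i : Fin 3) : hexLattice.Adj x (nbr x i) := ⟨i, rfl⟩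

/-- The sum over `Fin 3` in `energyChange` below is a sum over distinct neighbours. -/
theorem nbr_injective (x : Site) : Function.Injective (nbr x) := by
  obtain ⟨a, b, c⟩ := x
  intro i j
  cases c <;> fin_cases i <;> fin_cases j <;> simp [nbr] <;> omega

def origin : Site := (0, 0, false)

/-! ### Energy and flip rule -/

/-- A spin configuration: a value in `{-1, +1}` at every site. -/
abbrev Config : Type := Site → ℤˣ

/-- A coupling for every nearest neighbour pair. -/
abbrev Couplings : Type := hexLattice.edgeSet → ℝ

/-- The coupling between `x` and its `i`-th neighbour. -/
def coupling (J : Couplings) (x : Site) (i : Fin 3) : ℝ :=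
  J ⟨s(x, nbr x i), adj_nbr x i⟩

def spin (η : Config) (x : Site) : ℝ := ((η x : ℤ) : ℝ)

/-- The change of the energy `-∑ J_{x,y} η_x η_y - h ∑ η_x` caused by flipping the spin at `x`. -/
def energyChange (J : Couplings) (h : ℝ) (η : Config) (x : Site) : ℝ :=
  2 * ∑ i, coupling J x i * spin η x * spin η (nbr x i) + 2 * h * spin η x

open Classical in
/-- The spin at `x` right after a clock ring at `x` that finds the configuration `η`: flip if this
lowers the energy, do not flip if it raises it, and toss a coin if the energy does not change. -/
noncomputable def updatedSpin (J : Couplings) (h : ℝ) (coin : Bool) (η : Config) (x : Site) : ℤˣ :=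
  if energyChange J h η x < 0 ∨ (energyChange J h η x = 0 ∧ coin = true) then -η x else η x

/-! ### The randomness -/

/-- Gaps between the consecutive rings of each clock, and the tie-breaking coin of each ring. -/
abbrev Clocks : Type := (Site × ℕ → ℝ) × (Site × ℕ → Bool)

/-- Initial configuration, clocks and coins, couplings. -/
abbrev Env : Type := Config × Clocks × Couplings

/-- Independent spins, equal to `+1` with probability `lam` and to `-1` with probability
`1 - lam`. -/
noncomputable def initialLaw (lam : unitInterval) : Measure Config :=
  Measure.infinitePi fun _ => bernoulliMeasure (1 : ℤˣ) (-1) lam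

/-- Independent rate one Poisson clocks at the sites (independent exponential gaps of mean one) and
independent fair coins. -/
noncomputable def clockLaw : Measure Clocks :=
  (Measure.infinitePi fun _ => expMeasure 1).prod
    (Measure.infinitePi fun _ => uniformOn (Set.univ : Set Bool))

/-- Independent couplings with common law `ν`. -/
noncomputable def couplingLaw (ν : Measure ℝ) : Measure Couplings :=
  Measure.infinitePi fun _ => ν

noncomputable def envLaw (lam : unitInterval) (ν : Measure ℝ) : Measure Env :=
  (initialLaw lam).prod (clockLaw.prod (couplingLaw ν))

instance : IsProbabilityMeasure (expMeasure 1) := isProbabilityMeasure_expMeasure one_pos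

instance (lam : unitInterval) : IsProbabilityMeasure (initialLaw lam) := by
  unfold initialLaw; infer_instance

instance : IsProbabilityMeasure clockLaw := by
  unfold clockLaw; infer_instance

instance (ν : Measure ℝ) [IsProbabilityMeasure ν] : IsProbabilityMeasure (couplingLaw ν) := by
  unfold couplingLaw; infer_instance

instance (lam : unitInterval) (ν : Measure ℝ) [IsProbabilityMeasure ν] :
    IsProbabilityMeasure (envLaw lam ν) := by
  unfold envLaw; infer_instance

namespace Env

def init (ω : Env) : Config := ω.1

def gap (ω : Env) (x : Site) (n : ℕ) : ℝ := ω.2.1.1 (x, n)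

def coin (ω : Env) (x : Site) (n : ℕ) : Bool := ω.2.1.2 (x, n)

def couplings (ω : Env) : Couplings := ω.2.2

/-- The time of the `n`-th ring (counted from `0`) of the clock at `x`. -/
def ringTime (ω : Env) (x : Site) (n : ℕ) : ℝ := ∑ k ∈ Finset.range (n + 1), ω.gap x k

end Env

/-! ### The dynamics -/

/-- `σ t x`, `t ≥ 0`, is the (right-continuous) evolution of the spins in the environment `ω` with
field `h`: it starts from the initial configuration, the spin at `x` does not change while the
clock at `x` does not ring, and at a ring it is updated according to the configuration just
before the ring. -/
structure IsTrajectory (h : ℝ) (ω : Env) (σ : ℝ → Config) : Prop where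
  initial : σ 0 = ω.init
  constant : ∀ (x : Site) (s t : ℝ), 0 ≤ s → s ≤ t →
    (∀ n, ω.ringTime x n ∉ Set.Ioc s t) → σ t x = σ s x
  update : ∀ (x : Site) (n : ℕ), ∀ᶠ s in 𝓝[<] (ω.ringTime x n),
    σ (ω.ringTime x n) x = updatedSpin ω.couplings h (ω.coin x n) (σ s) x

/-- The spin at `x` flips at some time after `t`: its value at a time `s > t` is
not the value it has just before `s`. -/
def FlipsAfter (σ : ℝ → Config) (x : Site) (t : ℝ) : Prop :=
  ∃ s > t, ∀ᶠ r in 𝓝[<] s, σ s x = -σ r x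

/-- The probability that the origin flips after time `t`. -/
noncomputable def flipProb (lam : unitInterval) (ν : Measure ℝ) (h t : ℝ) : ENNReal :=
  envLaw lam ν {ω | ∃ σ, IsTrajectory h ω σ ∧ FlipsAfter σ origin t}

end ZeroTempIsing

/-!
Why the theorem is true. Since `h ≥ 2` and the couplings are less than `1`, a spin with at least one
plus neighbour becomes or stays plus at each of its rings (`updatedSpin_eq_one_of_adj`). Hence two
neighbouring plus spins protect each other forever, and a site next to a spin that stays plus
becomes plus, and stays so, at its next ring (`IsTrajectory.stablePlus_of_ring`). The stable plus
spins therefore grow as in first-passage percolation with exponential passage times, and a single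
one of them eventually makes the whole lattice plus (`IsTrajectory.exists_stablePlus`).

Existence of a trajectory needs only clocks whose rings do not accumulate: every finite set of rings
can be processed in order of time, and since each update looks at finitely many spins, compactness
gives a simultaneous solution for all rings (`Env.Regular.exists_isTrajectory`).

For the rate, consider a zigzag path of cells that starts at the origin. Each cell contains a seed, a
stable plus spin at time `1`, with probability bounded below and independently of the other
cells: if `lam > 0`, the cell may consist of two plus spins initially; if `lam = 0`, a minus spin
whose couplings are at most `h / 3` may turn plus and be protected by its neighbour before its next
ring (`IsTrajectory.stablePlus_of_nucleation`). So the first `n` cells fail to contain a seed with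
probability exponentially small in `n`. The spread from a seed in cell `k < n` to the origin waits
successively for rings at `2 k` different sites; by the lack of memory of the clocks
(`gapLaw_silent_le`) and a union bound over the waiting times, it takes longer than `10 n` time units
with exponentially small probability (`siteClockLaw_inter_delayed_le`). A union bound over `k`
avoids any independence between seeds and spread (`envLaw_unstable_le`).

This gives a bound `C * exp (-c * t)`. To have the constant `1`, the probability that the origin is
stable at time `t` must be at least of order `t` for small `t`. If `lam > 0` it is bounded below; if
`lam = 0`, nucleation at the origin with first ring before `t` has probability `κ * (1 - exp (-t))`
(`exists_exp_bound`, `exists_envLaw_unstable_le_exp`).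
-/

namespace ZeroTempIsing

/-! ### Single updates -/

theorem coupling_mem {J : Couplings} (hJ : ∀ e, J e ∈ Set.Ico (0 : ℝ) 1) (x : Site) (i : Fin 3) :
    coupling J x i ∈ Set.Ico (0 : ℝ) 1 := hJ _

theorem spin_eq (η : Config) (x : Site) : spin η x = 1 ∨ spin η x = -1 := by
  unfold spin
  rcases Int.units_eq_one_or (η x) with h | h <;> simp [h]

/-- Since the couplings are less than `1` and `h ≥ 2`, one plus neighbour forces the updated spin to
be plus. -/
theorem updatedSpin_eq_one_of_adj {J : Couplings} (hJ : ∀ e, J e ∈ Set.Ico (0 : ℝ) 1) {h : ℝ}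
    (hh : 2 ≤ h) (c : Bool) {η : Config} {x y : Site} (hxy : hexLattice.Adj x y) (hy : η y = 1) :
    updatedSpin J h c η x = 1 := by
  obtain ⟨i, rfl⟩ := hxy
  have key : 0 < h + ∑ i, coupling J x i * spin η (nbr x i) := by
    have hi : spin η (nbr x i) = 1 := by simp [spin, hy]
    have hb : ∀ j, -1 < coupling J x j * spin η (nbr x j) := by
      intro j
      have := coupling_mem hJ x j
      rcases spin_eq η (nbr x j) with h' | h' <;> rw [h'] <;> linarith [this.1, this.2]
    have hi0 : 0 ≤ coupling J x i * spin η (nbr x i) := by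
      rw [hi, mul_one]; exact (coupling_mem hJ x i).1
    have h0 := hb 0
    have h1 := hb 1
    have h2 := hb 2
    rw [Fin.sum_univ_three]
    fin_cases i <;> simp at hi0 <;> linarith
  have hE : energyChange J h η x =
      2 * spin η x * (h + ∑ i, coupling J x i * spin η (nbr x i)) := by
    unfold energyChange
    rw [Fin.sum_univ_three, Fin.sum_univ_three]; ring
  unfold updatedSpin
  rcases Int.units_eq_one_or (η x) with hx | hx
  · have : spin η x = 1 := by simp [spin, hx]
    rw [hE, this, if_neg, hx]
    rintro (h' | ⟨h', -⟩) <;> linarith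
  · have : spin η x = -1 := by simp [spin, hx]
    rw [hE, this, if_pos, hx, neg_neg]
    left; linarith

/-- If the three couplings at `x` are at most `h / 3`, then the field outweighs them, possibly with
a tie, and a minus spin whose coin shows heads becomes plus. -/
theorem updatedSpin_eq_one_of_le {J : Couplings} (hJ : ∀ e, J e ∈ Set.Ico (0 : ℝ) 1) {h : ℝ}
    {η : Config} {x : Site} (hx : η x = -1) (hJx : ∀ i, coupling J x i ≤ h / 3) :
    updatedSpin J h true η x = 1 := by
  have hs : spin η x = -1 := by simp [spin, hx]
  have hb : ∀ j, -(h / 3) ≤ coupling J x j * spin η (nbr x j) := by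
    intro j
    have := (coupling_mem hJ x j).1
    have := hJx j
    rcases spin_eq η (nbr x j) with h' | h' <;> rw [h'] <;> linarith
  have hE : energyChange J h η x ≤ 0 := by
    have h0 := hb 0
    have h1 := hb 1
    have h2 := hb 2
    unfold energyChange
    rw [Fin.sum_univ_three, hs]; linarith
  unfold updatedSpin
  rw [if_pos, hx, neg_neg]
  rcases hE.lt_or_eq with h' | h'
  · exact Or.inl h'
  · exact Or.inr ⟨h', rfl⟩

/-! ### Ring times -/

/-- The almost sure properties of the environment that the pathwise arguments use. -/
structure Env.Regular (ω : Env) : Prop where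
  gap_pos : ∀ x n, 0 < ω.gap x n
  tendsto_ringTime : ∀ x, Tendsto (ω.ringTime x) atTop atTop
  couplings_mem : ∀ e, ω.couplings e ∈ Set.Ico (0 : ℝ) 1

theorem Env.ringTime_zero (ω : Env) (x : Site) : ω.ringTime x 0 = ω.gap x 0 := by
  simp [Env.ringTime]

theorem Env.ringTime_succ (ω : Env) (x : Site) (n : ℕ) :
    ω.ringTime x (n + 1) = ω.ringTime x n + ω.gap x (n + 1) := by
  simp [Env.ringTime, Finset.sum_range_succ]

namespace Env.Regular

variable {ω : Env} (hω : ω.Regular)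
include hω

theorem strictMono_ringTime (x : Site) : StrictMono (ω.ringTime x) :=
  strictMono_nat_of_lt_succ fun n => by
    rw [Env.ringTime_succ]; linarith [hω.gap_pos x (n + 1)]

theorem ringTime_pos (x : Site) (n : ℕ) : 0 < ω.ringTime x n :=
  Finset.sum_pos (fun _ _ => hω.gap_pos x _) ⟨0, by simp⟩

theorem exists_ringTime_gt (x : Site) (t : ℝ) : ∃ n, t < ω.ringTime x n :=
  ((hω.tendsto_ringTime x).eventually_gt_atTop t).exists

theorem eventually_no_ring_left (x : Site) (r : ℝ) :
    ∀ᶠ s in 𝓝[<] r, ∀ n, ω.ringTime x n ∉ Set.Ioo s r := by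
  obtain ⟨N, hN⟩ := ((hω.tendsto_ringTime x).eventually_gt_atTop r).exists_forall_of_atTop
  have : ∀ᶠ s in 𝓝[<] r, ∀ n ∈ Finset.range N, ω.ringTime x n ∉ Set.Ioo s r := by
    rw [Filter.eventually_all_finset]
    intro n _
    by_cases hn : ω.ringTime x n < r
    · filter_upwards [Ioo_mem_nhdsLT hn] with s hs h'
      exact lt_asymm h'.1 hs.1
    · exact Eventually.of_forall fun s h' => hn h'.2
  filter_upwards [this] with s hs n h'
  by_cases hn : n < N
  · exact hs n (Finset.mem_range.2 hn) h'
  · exact lt_asymm h'.2 (hN n (not_lt.1 hn))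

theorem eventually_no_ring_right (x : Site) (r : ℝ) :
    ∀ᶠ s in 𝓝[>] r, ∀ n, ω.ringTime x n ∉ Set.Ioc r s := by
  obtain ⟨N, hN⟩ := ((hω.tendsto_ringTime x).eventually_gt_atTop (r + 1)).exists_forall_of_atTop
  have : ∀ᶠ s in 𝓝[>] r, ∀ n ∈ Finset.range N, ω.ringTime x n ∉ Set.Ioc r s := by
    rw [Filter.eventually_all_finset]
    intro n _
    by_cases hn : r < ω.ringTime x n
    · filter_upwards [Ioo_mem_nhdsGT hn] with s hs h'
      exact not_lt.2 h'.2 hs.2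
    · exact Eventually.of_forall fun s h' => hn h'.1
  filter_upwards [this, Ioo_mem_nhdsGT (lt_add_one r)] with s hs hs1 n h'
  by_cases hn : n < N
  · exact hs n (Finset.mem_range.2 hn) h'
  · linarith [h'.2, hs1.2, hN n (not_lt.1 hn)]

end Env.Regular

/-! ### Stability of plus spins along a trajectory -/

/-- Induction over continuous time. -/
theorem real_induction {P : ℝ → Prop} {a : ℝ} (h0 : P a)
    (hleft : ∀ r > a, (∀ s, a ≤ s → s < r → P s) → P r)
    (hright : ∀ r ≥ a, P r → ∀ᶠ s in 𝓝[>] r, P s) : ∀ t ≥ a, P t := by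
  by_contra! hne
  obtain ⟨t, hat, ht⟩ := hne
  set S := {s | a ≤ s ∧ ¬ P s} with hS
  have hSne : S.Nonempty := ⟨t, hat, ht⟩
  have hSb : BddBelow S := ⟨a, fun s hs => hs.1⟩
  have har : a ≤ sInf S := le_csInf hSne fun s hs => hs.1
  have hbelow : ∀ s, a ≤ s → s < sInf S → P s := fun s has hs => by
    by_contra hP
    exact not_le.2 hs (csInf_le hSb ⟨has, hP⟩)
  have hPr : P (sInf S) := by
    rcases har.eq_or_lt with h' | h'
    · rwa [← h']
    · exact hleft _ h' hbelow
  obtain ⟨b, hb, hb'⟩ := (mem_nhdsGT_iff_exists_Ioo_subset).1 (hright _ har hPr)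
  obtain ⟨s, hs, hsb⟩ := exists_lt_of_csInf_lt hSne hb
  rcases (csInf_le hSb hs).eq_or_lt with h' | h'
  · exact hs.2 (h' ▸ hPr)
  · exact hs.2 (hb' ⟨h', hsb⟩)

/-- The spin at `x` is plus from time `s` on. -/
def StablePlus (σ : ℝ → Config) (x : Site) (s : ℝ) : Prop := ∀ t ≥ s, σ t x = 1

theorem StablePlus.mono {σ : ℝ → Config} {x : Site} {s t : ℝ} (h : StablePlus σ x s)
    (hst : s ≤ t) : StablePlus σ x t := fun u hu => h u (hst.trans hu)

theorem StablePlus.not_flipsAfter {σ : ℝ → Config} {x : Site} {s : ℝ} (h : StablePlus σ x s) :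
    ¬ FlipsAfter σ x s := by
  rintro ⟨u, hu, hev⟩
  obtain ⟨r, hr, hr'⟩ := (hev.and (Ioo_mem_nhdsLT hu)).exists
  rw [h u hu.le, h r hr'.1.le] at hr
  exact absurd hr (by decide)

namespace IsTrajectory

variable {h : ℝ} {ω : Env} {σ : ℝ → Config} (hσ : IsTrajectory h ω σ) (hω : ω.Regular)
include hσ hω

theorem eventually_eq_left {x : Site} {r : ℝ} (hr : 0 < r) (hx : ∀ n, ω.ringTime x n ≠ r) :
    ∀ᶠ s in 𝓝[<] r, σ r x = σ s x := by
  filter_upwards [hω.eventually_no_ring_left x r, Ioo_mem_nhdsLT hr] with s hs hs'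
  refine hσ.constant x s r hs'.1.le hs'.2.le fun n hn => ?_
  exact hs n ⟨hn.1, lt_of_le_of_ne hn.2 (hx n)⟩

theorem eventually_eq_right (x : Site) {r : ℝ} (hr : 0 ≤ r) :
    ∀ᶠ s in 𝓝[>] r, σ s x = σ r x := by
  filter_upwards [hω.eventually_no_ring_right x r, self_mem_nhdsWithin] with s hs hs'
  exact hσ.constant x r s hr (le_of_lt hs') hs

/-- Before the first ring the spin is the initial one. -/
theorem eq_init {x : Site} {t : ℝ} (ht : 0 ≤ t) (ht' : t < ω.gap x 0) : σ t x = ω.init x := by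
  rw [hσ.constant x 0 t le_rfl ht, hσ.initial]
  intro n hn
  have := (hω.strictMono_ringTime x).monotone (Nat.zero_le n)
  rw [Env.ringTime_zero] at this
  linarith [hn.2]

variable (hh : 2 ≤ h)
include hh

/-- A spin is plus at time `r` if it is so at times arbitrarily close before `r` and a neighbour is
plus just before `r`. -/
theorem eq_one_of_left {x y : Site} (hxy : hexLattice.Adj x y) {r : ℝ} (hr : 0 < r)
    (hx : ∃ᶠ s in 𝓝[<] r, σ s x = 1)
    (hy : ∀ᶠ s in 𝓝[<] r, σ s y = 1) : σ r x = 1 := by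
  by_cases hring : ∃ n, ω.ringTime x n = r
  · obtain ⟨n, rfl⟩ := hring
    obtain ⟨s, hs, hs'⟩ := ((hσ.update x n).and hy).exists
    rw [hs]
    exact updatedSpin_eq_one_of_adj hω.couplings_mem hh _ hxy hs'
  · push Not at hring
    obtain ⟨s, hs, hs'⟩ := (hx.and_eventually (hσ.eventually_eq_left hω hr hring)).exists
    rw [hs', hs]

/-- Two neighbouring plus spins protect each other forever. -/
theorem stablePlus_pair {x y : Site} (hxy : hexLattice.Adj x y) {s : ℝ} (hs : 0 ≤ s)
    (hx : σ s x = 1) (hy : σ s y = 1) : StablePlus σ x s ∧ StablePlus σ y s := by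
  have key : ∀ t ≥ s, σ t x = 1 ∧ σ t y = 1 := by
    refine real_induction ⟨hx, hy⟩ (fun r hr IH => ?_) (fun r hr IH => ?_)
    · have hev : ∀ᶠ u in 𝓝[<] r, σ u x = 1 ∧ σ u y = 1 := by
        filter_upwards [Ioo_mem_nhdsLT hr] with u hu using IH u hu.1.le hu.2
      have hr0 : 0 < r := hs.trans_lt hr
      exact ⟨hσ.eq_one_of_left hω hh hxy hr0 (hev.mono fun _ hu => hu.1).frequently
          (hev.mono fun _ hu => hu.2),
        hσ.eq_one_of_left hω hh hxy.symm hr0 (hev.mono fun _ hu => hu.2).frequently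
          (hev.mono fun _ hu => hu.1)⟩
    · have hr0 : 0 ≤ r := hs.trans hr
      filter_upwards [hσ.eventually_eq_right hω x hr0, hσ.eventually_eq_right hω y hr0]
        with u hux huy
      exact ⟨hux.trans IH.1, huy.trans IH.2⟩
  exact ⟨fun t ht => (key t ht).1, fun t ht => (key t ht).2⟩

/-- A ring next to a spin that has been plus for a while creates a protected pair. -/
theorem stablePlus_pair_of_ring {x y : Site} (hxy : hexLattice.Adj x y) {n : ℕ}
    (hy : ∀ᶠ s in 𝓝[<] (ω.ringTime x n), σ s y = 1) (hy' : σ (ω.ringTime x n) y = 1) :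
    StablePlus σ x (ω.ringTime x n) ∧ StablePlus σ y (ω.ringTime x n) := by
  refine hσ.stablePlus_pair hω hh hxy (hω.ringTime_pos x n).le ?_ hy'
  obtain ⟨s, hs, hs'⟩ := ((hσ.update x n).and hy).exists
  rw [hs]
  exact updatedSpin_eq_one_of_adj hω.couplings_mem hh _ hxy hs'

/-- Stable plus spins spread: a site next to one is stable from its next ring on. -/
theorem stablePlus_of_ring {x y : Site} (hxy : hexLattice.Adj x y) {s : ℝ}
    (hy : StablePlus σ y s) {n : ℕ} (hn : s < ω.ringTime x n) :
    StablePlus σ x (ω.ringTime x n) := by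
  refine (hσ.stablePlus_pair_of_ring hω hh hxy ?_ (hy _ hn.le)).1
  filter_upwards [Ioo_mem_nhdsLT hn] with u hu using hy u hu.1.le

theorem exists_stablePlus_of_adj {x y : Site} (hxy : hexLattice.Adj x y)
    (hy : ∃ s, StablePlus σ y s) : ∃ s, StablePlus σ x s := by
  obtain ⟨s, hs⟩ := hy
  obtain ⟨n, hn⟩ := hω.exists_ringTime_gt x s
  exact ⟨_, hσ.stablePlus_of_ring hω hh hxy hs hn⟩

/-- One stable plus spin eventually makes the whole (connected) lattice plus. -/
theorem exists_stablePlus (ho : ∃ s, StablePlus σ origin s) (x : Site) :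
    ∃ s, StablePlus σ x s := by
  have step : ∀ {x y : Site} (i : Fin 3), nbr x i = y → (∃ s, StablePlus σ y s) →
      ∃ s, StablePlus σ x s := fun i hi => hσ.exists_stablePlus_of_adj hω hh ⟨i, hi⟩
  have hbool : ∀ a b : ℤ, (∃ s, StablePlus σ (a, b, false) s) ↔
      ∃ s, StablePlus σ (a, b, true) s := fun a b =>
    ⟨step 0 (by simp [nbr]), step 0 (by simp [nbr])⟩
  have ha : ∀ a b : ℤ, (∃ s, StablePlus σ (a, b, false) s) ↔
      ∃ s, StablePlus σ (a + 1, b, false) s := fun a b =>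
    ⟨fun H => step 1 (by simp [nbr]) ((hbool a b).1 H),
      fun H => (hbool a b).2 (step 1 (by simp [nbr]) H)⟩
  have hb : ∀ a b : ℤ, (∃ s, StablePlus σ (a, b, false) s) ↔
      ∃ s, StablePlus σ (a, b + 1, false) s := fun a b =>
    ⟨fun H => step 2 (by simp [nbr]) ((hbool a b).1 H),
      fun H => (hbool a b).2 (step 2 (by simp [nbr]) H)⟩
  have h1 : ∀ a : ℤ, ∃ s, StablePlus σ (a, 0, false) s := by
    intro a
    induction a with
    | zero => exact ho
    | succ n IH => exact (ha _ _).1 IH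
    | pred n IH => exact (ha _ _).2 (by simpa using IH)
  have h2 : ∀ a b : ℤ, ∃ s, StablePlus σ (a, b, false) s := by
    intro a b
    induction b with
    | zero => exact h1 a
    | succ n IH => exact (hb _ _).1 IH
    | pred n IH => exact (hb _ _).2 (by simpa using IH)
  obtain ⟨a, b, c⟩ := x
  cases c
  · exact h2 a b
  · exact (hbool a b).1 (h2 a b)

omit hh in
/-- Creation of a stable plus spin out of a minus spin: if the couplings at `x` are weak, the first
ring of `x` is early with coin heads and the second one is late, and in between a neighbour of
`x` has its first ring, then `x` is plus from its first ring on. -/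
theorem stablePlus_of_nucleation (hh : 2 ≤ h) {x y : Site} (hxy : hexLattice.Adj y x)
    (hx : ω.init x = -1) (hJ : ∀ i, coupling ω.couplings x i ≤ h / 3)
    (hcoin : ω.coin x 0 = true) (hx0 : ω.gap x 0 ≤ 1) (hx1 : 2 < ω.gap x 1)
    (hy : ω.gap y 0 ∈ Set.Ioc (1 : ℝ) 2) : StablePlus σ x (ω.gap x 0) := by
  have hT : σ (ω.gap x 0) x = 1 := by
    have hup := hσ.update x 0
    rw [Env.ringTime_zero] at hup
    obtain ⟨s, hs, hs'⟩ := (hup.and (Ioo_mem_nhdsLT (hω.gap_pos x 0))).exists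
    rw [hs, hcoin]
    refine updatedSpin_eq_one_of_le hω.couplings_mem ?_ hJ
    rw [hσ.eq_init hω hs'.1.le hs'.2, hx]
  have hbetween : ∀ t, ω.gap x 0 ≤ t → t ≤ 2 → σ t x = 1 := by
    intro t ht ht2
    rw [hσ.constant x _ t (hω.gap_pos x 0).le ht, hT]
    rintro (_ | n) hn
    · rw [Env.ringTime_zero] at hn
      exact lt_irrefl _ hn.1
    · have := (hω.strictMono_ringTime x).monotone (Nat.le_add_left 1 n)
      rw [Env.ringTime_succ, Env.ringTime_zero] at this
      linarith [hn.2, hω.gap_pos x 0]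
  have hpair : StablePlus σ x (ω.gap y 0) := by
    have := (hσ.stablePlus_pair_of_ring hω hh hxy (n := 0) ?_ ?_).2
    · rwa [Env.ringTime_zero] at this
    · rw [Env.ringTime_zero]
      filter_upwards [Ioo_mem_nhdsLT hy.1] with u hu
      exact hbetween u (by linarith [hu.1]) (by linarith [hu.2, hy.2])
    · rw [Env.ringTime_zero]
      exact hbetween _ (by linarith [hy.1]) hy.2
  intro t ht
  rcases le_total t 2 with h2 | h2
  · exact hbetween t ht h2
  · exact hpair t (hy.2.trans h2)

end IsTrajectory

/-! ### Existence of a trajectory -/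

namespace Env

open Classical in
/-- The number of rings at `x` strictly before time `t`, for a clock whose ring times
increase to infinity (and `0` if all rings are before `t`). -/
noncomputable def countBefore (ω : Env) (x : Site) (t : ℝ) : ℕ :=
  if H : ∃ n, t ≤ ω.ringTime x n then Nat.find H else 0

open Classical in
/-- The number of rings at `x` up to and including time `t`, under the same proviso. -/
noncomputable def countUpTo (ω : Env) (x : Site) (t : ℝ) : ℕ :=
  if H : ∃ n, t < ω.ringTime x n then Nat.find H else 0

/-- `v x n` describes the spin at `x` after `n` rings. This is the update rule for ring `n` at `x`. -/
def UpdateRule (h : ℝ) (ω : Env) (v : Site → ℕ → ℤˣ) (x : Site) (n : ℕ) : Prop :=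
  v x (n + 1) = updatedSpin ω.couplings h (ω.coin x n)
    (fun y => v y (ω.countBefore y (ω.ringTime x n))) x

end Env

/-- The updated spin depends only on the spins at the site and its neighbours. -/
theorem updatedSpin_congr {J : Couplings} {h : ℝ} {c : Bool} {η η' : Config} {x : Site}
    (hx : η x = η' x) (hn : ∀ i, η (nbr x i) = η' (nbr x i)) :
    updatedSpin J h c η x = updatedSpin J h c η' x := by
  have : energyChange J h η x = energyChange J h η' x := by
    simp only [energyChange, spin, hx, hn]
  rw [updatedSpin, updatedSpin, this, hx]

namespace Env.Regular

variable {ω : Env} (hω : ω.Regular)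
include hω

theorem lt_countBefore_iff (x : Site) (t : ℝ) (n : ℕ) :
    n < ω.countBefore x t ↔ ω.ringTime x n < t := by
  have H : ∃ n, t ≤ ω.ringTime x n := (hω.exists_ringTime_gt x t).imp fun _ => le_of_lt
  rw [countBefore, dif_pos H]
  constructor
  · exact fun hn => not_le.1 (Nat.find_min H hn)
  · intro hn
    exact (hω.strictMono_ringTime x).lt_iff_lt.1 (hn.trans_le (Nat.find_spec H))

theorem lt_countUpTo_iff (x : Site) (t : ℝ) (n : ℕ) :
    n < ω.countUpTo x t ↔ ω.ringTime x n ≤ t := by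
  have H := hω.exists_ringTime_gt x t
  rw [countUpTo, dif_pos H]
  constructor
  · exact fun hn => not_lt.1 (Nat.find_min H hn)
  · intro hn
    exact (hω.strictMono_ringTime x).lt_iff_lt.1 (hn.trans_lt (Nat.find_spec H))

theorem countUpTo_ringTime (x : Site) (n : ℕ) : ω.countUpTo x (ω.ringTime x n) = n + 1 :=
  eq_of_forall_lt_iff fun m => by
    rw [hω.lt_countUpTo_iff, (hω.strictMono_ringTime x).le_iff_le, Nat.lt_succ_iff]

theorem eventually_countUpTo (x : Site) (r : ℝ) :
    ∀ᶠ s in 𝓝[<] r, ω.countUpTo x s = ω.countBefore x r := by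
  filter_upwards [hω.eventually_no_ring_left x r, self_mem_nhdsWithin] with s hs hsr
  refine eq_of_forall_lt_iff fun m => ?_
  rw [hω.lt_countUpTo_iff, hω.lt_countBefore_iff]
  exact ⟨fun h' => h'.trans_lt hsr, fun h' => not_lt.1 fun h'' => hs m ⟨h'', h'⟩⟩

/-- Any finite set of rings can be processed, in the order of their times. -/
theorem exists_updateRule_finset (h : ℝ) (F : Finset (Site × ℕ)) :
    ∃ v : Site → ℕ → ℤˣ, (∀ x, v x 0 = ω.init x) ∧ ∀ p ∈ F, ω.UpdateRule h v p.1 p.2 := by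
  classical
  induction F using Finset.induction_on_max_value (fun p : Site × ℕ => ω.ringTime p.1 p.2) with
  | empty => exact ⟨fun x _ => ω.init x, fun _ => rfl, by simp⟩
  | insert a s ha hmax IH =>
    obtain ⟨x, n⟩ := a
    obtain ⟨v, hv0, hv⟩ := IH
    let u : ℤˣ := updatedSpin ω.couplings h (ω.coin x n)
      (fun y => v y (ω.countBefore y (ω.ringTime x n))) x
    let w : Site → ℕ → ℤˣ := fun y m => if (y, m) = (x, n + 1) then u else v y m
    -- rings up to the time of the last ring do not see its outcome
    have hw : ∀ t ≤ ω.ringTime x n, ∀ y, w y (ω.countBefore y t) = v y (ω.countBefore y t) := by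
      intro t ht y
      refine if_neg fun heq => ?_
      rw [Prod.mk.injEq] at heq
      obtain ⟨rfl, heq⟩ := heq
      exact not_lt.2 ht ((hω.lt_countBefore_iff y t n).1 (heq ▸ Nat.lt_succ_self n))
    refine ⟨w, fun y => by simp [w, hv0], fun p hp => ?_⟩
    rw [Finset.mem_insert] at hp
    rcases hp with rfl | hp
    · simp only [UpdateRule, hw _ le_rfl]
      exact if_pos rfl
    · have hne : (p.1, p.2 + 1) ≠ (x, n + 1) := by
        intro heq
        simp only [Prod.mk.injEq, add_left_inj] at heq
        exact ha (by rwa [← heq.1, ← heq.2])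
      have := hv p hp
      simp only [UpdateRule, hw _ (hmax p hp)] at this ⊢
      rw [← this]
      exact if_neg hne

/-- By compactness, all rings can be processed simultaneously: the spins obtained from finite sets of
rings have a limit along an ultrafilter, and each update rule involves only finitely many
spins. -/
theorem exists_updateRule (h : ℝ) :
    ∃ v : Site → ℕ → ℤˣ, (∀ x, v x 0 = ω.init x) ∧ ∀ x n, ω.UpdateRule h v x n := by
  choose V hV0 hV using hω.exists_updateRule_finset h
  let U : Ultrafilter (Finset (Site × ℕ)) := Ultrafilter.of atTop
  have hlim : ∀ x n, ∃ a, ∀ᶠ F in (U : Filter (Finset (Site × ℕ))), V F x n = a := by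
    intro x n
    by_cases h1 : ∀ᶠ F in (U : Filter (Finset (Site × ℕ))), V F x n = 1
    · exact ⟨1, h1⟩
    · rw [← Ultrafilter.eventually_not] at h1
      exact ⟨-1, h1.mono fun F hF => (Int.units_eq_one_or _).resolve_left hF⟩
  choose v hv using hlim
  refine ⟨v, fun x => ?_, fun x n => ?_⟩
  · obtain ⟨F, hF⟩ := (hv x 0).exists
    rw [← hF, hV0]
  · have hmem : ∀ᶠ F in (U : Filter (Finset (Site × ℕ))), (x, n) ∈ F := by
      refine Ultrafilter.of_le atTop ?_
      filter_upwards [eventually_ge_atTop {(x, n)}] with F hF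
      exact hF (Finset.mem_singleton_self _)
    have hn : ∀ᶠ F in (U : Filter (Finset (Site × ℕ))), ∀ i,
        V F (nbr x i) (ω.countBefore (nbr x i) (ω.ringTime x n)) =
          v (nbr x i) (ω.countBefore (nbr x i) (ω.ringTime x n)) :=
      Filter.eventually_all.2 fun i => hv _ _
    obtain ⟨F, hF, hF1, hF2, hF3⟩ := (hmem.and ((hv x (n + 1)).and
      ((hv x (ω.countBefore x (ω.ringTime x n))).and hn))).exists
    have := hV F (x, n) hF
    unfold UpdateRule at this ⊢
    rw [← hF1, this]
    exact updatedSpin_congr hF2 hF3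

theorem exists_isTrajectory (h : ℝ) : ∃ σ, IsTrajectory h ω σ := by
  obtain ⟨v, hv0, hv⟩ := hω.exists_updateRule h
  refine ⟨fun t x => v x (ω.countUpTo x t), ?_, ?_, ?_⟩
  · funext x
    have : ω.countUpTo x 0 = 0 := by
      by_contra hne
      exact not_lt.2 ((hω.lt_countUpTo_iff x 0 0).1 (Nat.pos_of_ne_zero hne)) (hω.ringTime_pos x 0)
    simp only [this, hv0]
  · intro x s t _ hst hno
    have : ω.countUpTo x t = ω.countUpTo x s := by
      refine eq_of_forall_lt_iff fun m => ?_
      rw [hω.lt_countUpTo_iff, hω.lt_countUpTo_iff]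
      exact ⟨fun h' => not_lt.1 fun h'' => hno m ⟨h'', h'⟩, fun h' => h'.trans hst⟩
    simp only [this]
  · intro x n
    filter_upwards [hω.eventually_countUpTo x (ω.ringTime x n),
      Filter.eventually_all.2 fun i => hω.eventually_countUpTo (nbr x i) (ω.ringTime x n)]
      with s hs hs'
    simp only [hω.countUpTo_ringTime]
    rw [hv x n]
    exact updatedSpin_congr (by simp only [hs]) fun i => by simp only [hs']

end Env.Regular

/-! ### Independent events -/

/-- In a product space, events that constrain disjoint finite sets of coordinates are independent. -/
theorem iIndepSet_pi {ι κ : Type*} {X : ι → Type*} [∀ i, MeasurableSpace (X i)]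
    (μ : ∀ i, Measure (X i)) [∀ i, IsProbabilityMeasure (μ i)] {I : κ → Finset ι}
    (hI : Pairwise (Function.onFun Disjoint I)) {t : ∀ i, Set (X i)}
    (ht : ∀ i, MeasurableSet (t i)) :
    iIndepSet (fun k => Set.pi (I k : Set ι) t) (Measure.infinitePi μ) := by
  classical
  rw [iIndepSet_iff_meas_biInter fun k => .pi (I k).countable_toSet fun i _ => ht i]
  intro S
  have : ⋂ k ∈ S, Set.pi (I k : Set ι) t = Set.pi (S.biUnion I : Finset ι) t := by
    ext f
    simp only [Set.mem_iInter, Set.mem_pi, Finset.coe_biUnion, Set.mem_iUnion, Finset.mem_coe]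
    exact ⟨fun H i ⟨k, hk, hi⟩ => H k hk i hi, fun H k hk i hi => H i ⟨k, hk, hi⟩⟩
  rw [this, Measure.infinitePi_pi _ fun i _ => ht i,
    Finset.prod_biUnion fun i _ j _ hij => hI hij]
  exact Finset.prod_congr rfl fun k _ => (Measure.infinitePi_pi _ fun i _ => ht i).symm

theorem iIndepSet_prod {κ X Y : Type*} [MeasurableSpace X] [MeasurableSpace Y] {μ : Measure X}
    {ν : Measure Y} [SFinite ν] {A : κ → Set X} {B : κ → Set Y} (hA : iIndepSet A μ)
    (hB : iIndepSet B ν) (hAm : ∀ k, MeasurableSet (A k)) (hBm : ∀ k, MeasurableSet (B k)) :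
    iIndepSet (fun k => A k ×ˢ B k) (μ.prod ν) := by
  rw [iIndepSet_iff_meas_biInter fun k => (hAm k).prod (hBm k)]
  intro S
  rcases S.eq_empty_or_nonempty with rfl | hS
  · have := hA.isProbabilityMeasure
    have := hB.isProbabilityMeasure
    simp
  have : ⋂ k ∈ S, A k ×ˢ B k = (⋂ k ∈ S, A k) ×ˢ (⋂ k ∈ S, B k) := by
    ext p
    simp only [Set.mem_iInter, Set.mem_prod]
    exact ⟨fun H => ⟨fun k hk => (H k hk).1, fun k hk => (H k hk).2⟩,
      fun H k hk => ⟨H.1 k hk, H.2 k hk⟩⟩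
  rw [this, Measure.prod_prod, hA.meas_biInter, hB.meas_biInter, ← Finset.prod_mul_distrib]
  simp only [Measure.prod_prod]

theorem iIndepSet_univ {κ X : Type*} [MeasurableSpace X] {μ : Measure X} [IsProbabilityMeasure μ] :
    iIndepSet (fun _ : κ => (Set.univ : Set X)) μ := by
  rw [iIndepSet_iff_meas_biInter fun _ => .univ]
  simp

theorem measureReal_biInter_compl {κ X : Type*} [MeasurableSpace X] {μ : Measure X}
    {A : κ → Set X} (hA : iIndepSet A μ) (hAm : ∀ k, MeasurableSet (A k)) (S : Finset κ) :
    μ.real (⋂ k ∈ S, (A k)ᶜ) = ∏ k ∈ S, (1 - μ.real (A k)) := by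
  have := hA.isProbabilityMeasure
  have h1 : μ (⋂ k ∈ S, (A k)ᶜ) = ∏ k ∈ S, μ (A k)ᶜ :=
    ((iIndepSet_iff_iIndep A μ).1 hA).meas_biInter fun k _ =>
      (MeasurableSpace.measurableSet_generateFrom (Set.mem_singleton _)).compl
  rw [measureReal_def, h1, ENNReal.toReal_prod]
  exact Finset.prod_congr rfl fun k _ => probReal_compl_eq_one_sub (hAm k)

/-! ### A single Poisson clock -/

theorem expMeasure_Iic {c : ℝ} (hc : 0 ≤ c) :
    (expMeasure 1).real (Set.Iic c) = 1 - Real.exp (-c) := by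
  rw [← cdf_eq_real, cdf_expMeasure_eq one_pos, if_pos hc, one_mul]

theorem expMeasure_Ioi {c : ℝ} (hc : 0 ≤ c) :
    expMeasure 1 (Set.Ioi c) = ENNReal.ofReal (Real.exp (-c)) := by
  rw [← ofReal_measureReal, ← Set.compl_Iic, probReal_compl_eq_one_sub measurableSet_Iic,
    expMeasure_Iic hc, sub_sub_cancel]

theorem ae_expMeasure_pos : ∀ᵐ x ∂(expMeasure 1), 0 < x := by
  have h0 : expMeasure 1 (Set.Iic 0) = 0 := by
    rw [← ofReal_measureReal, expMeasure_Iic le_rfl]; simp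
  rw [ae_iff]
  have : {x : ℝ | ¬ 0 < x} = Set.Iic 0 := by ext; simp
  rw [this, h0]

/-- The gaps of one clock. -/
noncomputable def gapLaw : Measure (ℕ → ℝ) := Measure.infinitePi fun _ => expMeasure 1

instance : IsProbabilityMeasure gapLaw := by unfold gapLaw; infer_instance

theorem ae_gapLaw_pos : ∀ᵐ g ∂gapLaw, ∀ n, 0 < g n :=
  ae_all_iff.2 fun n =>
    (measurePreserving_eval_infinitePi (fun _ : ℕ => expMeasure 1) n).quasiMeasurePreserving.ae
      ae_expMeasure_pos

/-- Infinitely many gaps exceed `1`, so the rings of a clock do not accumulate. -/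
theorem ae_gapLaw_tendsto :
    ∀ᵐ g ∂gapLaw, Tendsto (fun n => ∑ k ∈ Finset.range (n + 1), g k) atTop atTop := by
  let A : ℕ → Set (ℕ → ℝ) := fun n => Set.pi (({n} : Finset ℕ) : Set ℕ) fun _ => Set.Ioi 1
  have hAm : ∀ n, MeasurableSet (A n) := fun n =>
    .pi (Finset.countable_toSet _) fun _ _ => measurableSet_Ioi
  have hA : iIndepSet A gapLaw := iIndepSet_pi _
    (fun i j hij => by simpa [Function.onFun] using hij) fun _ => measurableSet_Ioi
  have hAmeas : ∀ n, gapLaw (A n) = ENNReal.ofReal (Real.exp (-1)) := fun n => by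
    rw [gapLaw, Measure.infinitePi_pi _ fun _ _ => measurableSet_Ioi, Finset.prod_singleton,
      expMeasure_Ioi zero_le_one]
  have hlim := measure_limsup_eq_one hAm hA (by
    simp only [hAmeas]
    exact ENNReal.tsum_const_eq_top_of_ne_zero (by simp [Real.exp_pos]))
  have hlim' : ∀ᵐ g ∂gapLaw, g ∈ limsup A atTop :=
    (prob_compl_eq_zero_iff (MeasurableSet.measurableSet_limsup hAm)).2 hlim
  filter_upwards [hlim', ae_gapLaw_pos] with g hg hpos
  rw [mem_limsup_iff_frequently_mem] at hg
  have hmono : Monotone fun n => ∑ k ∈ Finset.range n, g k :=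
    monotone_nat_of_le_succ fun n => by rw [Finset.sum_range_succ]; linarith [hpos n]
  refine (tendsto_add_atTop_iff_nat 1).2 ((tendsto_atTop_atTop_of_monotone' hmono) ?_)
  intro hbdd
  have hsum : Summable g := by
    obtain ⟨C, hC⟩ := hbdd
    exact summable_of_sum_range_le (c := C) (fun n => (hpos n).le) fun n => hC ⟨n, rfl⟩
  have hev := hsum.tendsto_atTop_zero.eventually_lt_const (zero_lt_one (α := ℝ))
  obtain ⟨n, hn, hn'⟩ := (hg.and_eventually hev).exists
  have : (1 : ℝ) < g n := hn n (by simp)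
  linarith

/-- Lack of memory: the conditional tail of an exponential gap after an independent time. -/
theorem measure_memoryless {Ω : Type*} [MeasurableSpace Ω] {P : Measure Ω}
    [IsProbabilityMeasure P] {X Y : Ω → ℝ} (hX : Measurable X) (hY : Measurable Y)
    (hXY : IndepFun X Y P) (hlaw : P.map Y = expMeasure 1) {s u : ℝ} (hu : 0 ≤ u) :
    P {ω | X ω ≤ s ∧ s + u < X ω + Y ω} =
      ENNReal.ofReal (Real.exp (-u)) * P {ω | X ω ≤ s ∧ s < X ω + Y ω} := by
  have key : ∀ v, 0 ≤ v → P {ω | X ω ≤ s ∧ s + v < X ω + Y ω} =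
      ∫⁻ a, (Set.Iic s).indicator (fun a => ENNReal.ofReal (Real.exp (-(s + v - a)))) a
        ∂(P.map X) := by
    intro v hv
    have hm : MeasurableSet {p : ℝ × ℝ | p.1 ≤ s ∧ s + v < p.1 + p.2} :=
      (measurableSet_le measurable_fst measurable_const).inter
        (measurableSet_lt measurable_const (measurable_fst.add measurable_snd))
    have h1 : P {ω | X ω ≤ s ∧ s + v < X ω + Y ω} =
        (P.map fun ω => (X ω, Y ω)) {p : ℝ × ℝ | p.1 ≤ s ∧ s + v < p.1 + p.2} := by
      rw [Measure.map_apply (hX.prodMk hY) hm]; rfl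
    rw [h1, (indepFun_iff_map_prod_eq_prod_map_map hX.aemeasurable hY.aemeasurable).1 hXY, hlaw,
      Measure.prod_apply hm]
    refine lintegral_congr fun a => ?_
    by_cases ha : a ≤ s
    · rw [Set.indicator_of_mem (show a ∈ Set.Iic s from ha),
        ← expMeasure_Ioi (by linarith : 0 ≤ s + v - a)]
      congr 1
      ext b
      simp only [Set.mem_preimage, Set.mem_ofPred_eq, Set.mem_Ioi]
      exact ⟨fun H => by linarith [H.2], fun H => ⟨ha, by linarith⟩⟩
    · rw [Set.indicator_of_notMem (show a ∉ Set.Iic s from ha)]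
      convert measure_empty (μ := expMeasure 1)
      ext b
      simp [ha]
  have k0 := key 0 le_rfl
  simp only [add_zero] at k0
  rw [key u hu, k0, ← lintegral_const_mul _ (by
    refine Measurable.indicator ?_ measurableSet_Iic
    fun_prop)]
  refine lintegral_congr fun a => ?_
  by_cases ha : a ≤ s
  · rw [Set.indicator_of_mem (show a ∈ Set.Iic s from ha),
      Set.indicator_of_mem (show a ∈ Set.Iic s from ha),
      ← ENNReal.ofReal_mul (Real.exp_pos _).le, ← Real.exp_add]
    congr 2; ring
  · rw [Set.indicator_of_notMem (show a ∉ Set.Iic s from ha),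
      Set.indicator_of_notMem (show a ∉ Set.Iic s from ha), mul_zero]

/-- The clock with gaps `g` does not ring in `(s, s + u]`. -/
def silent (s u : ℝ) : Set (ℕ → ℝ) :=
  {g | ∀ n, ∑ k ∈ Finset.range (n + 1), g k ∉ Set.Ioc s (s + u)}

theorem measurableSet_silent (s u : ℝ) : MeasurableSet (silent s u) := by
  have : silent s u = ⋂ n : ℕ, (fun g : ℕ → ℝ => ∑ k ∈ Finset.range (n + 1), g k) ⁻¹'
      (Set.Ioc s (s + u))ᶜ := by
    ext g; simp [silent]
  rw [this]
  exact MeasurableSet.iInter fun n =>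
    (Finset.measurable_sum _ fun i _ => measurable_pi_apply i) measurableSet_Ioc.compl

/-- The clock is silent in `(s, s + u]` with probability at most `exp (-u)` (in fact equal to it):
decompose according to the number of rings up to time `s` and use the lack of memory. -/
theorem gapLaw_silent_le {s u : ℝ} (hs : 0 ≤ s) (hu : 0 ≤ u) :
    gapLaw.real (silent s u) ≤ Real.exp (-u) := by
  -- exactly `n` rings up to time `s`, and the next one is after `s + v`
  let D : ℝ → ℕ → Set (ℕ → ℝ) := fun v n =>
    {g | ∑ k ∈ Finset.range n, g k ≤ s ∧ s + v < ∑ k ∈ Finset.range n, g k + g n}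
  have hXm : ∀ n, Measurable fun g : ℕ → ℝ => ∑ k ∈ Finset.range n, g k := fun n =>
    Finset.measurable_sum _ fun i _ => measurable_pi_apply i
  have hDm : ∀ v n, MeasurableSet (D v n) := fun v n =>
    (measurableSet_le (hXm n) measurable_const).inter
      (measurableSet_lt measurable_const ((hXm n).add (measurable_pi_apply n)))
  have hind : iIndepFun (fun (n : ℕ) (g : ℕ → ℝ) => g n) gapLaw :=
    iIndepFun_infinitePi (P := fun _ : ℕ => expMeasure 1) (X := fun _ x => x)
      fun _ => measurable_id
  have hD : ∀ n, gapLaw (D u n) = ENNReal.ofReal (Real.exp (-u)) * gapLaw (D 0 n) := by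
    intro n
    have hXY : IndepFun (fun g : ℕ → ℝ => ∑ k ∈ Finset.range n, g k) (fun g => g n) gapLaw := by
      have := hind.indepFun_finsetSum_of_notMem (fun i => measurable_pi_apply i)
        (s := Finset.range n) (i := n) (by simp)
      convert this using 1
      ext g; simp
    have := measure_memoryless (s := s) (hXm n) (measurable_pi_apply n) hXY
      (Measure.infinitePi_map_eval (fun _ : ℕ => expMeasure 1) n) hu
    simpa only [D, add_zero] using this
  have hcover : gapLaw (silent s u) ≤ gapLaw (⋃ n, D u n) := by
    refine measure_mono_ae ?_
    filter_upwards [ae_gapLaw_tendsto] with g hg hsil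
    have hex := (hg.eventually_gt_atTop s).exists
    classical
    refine Set.mem_iUnion.2 ⟨Nat.find hex, ?_, ?_⟩
    · rcases Nat.eq_zero_or_pos (Nat.find hex) with h0 | h0
      · rw [h0]; simpa using hs
      · obtain ⟨m, hm⟩ := Nat.exists_eq_succ_of_ne_zero h0.ne'
        rw [hm]
        exact not_lt.1 (Nat.find_min hex (by omega))
    · rw [← Finset.sum_range_succ]
      exact not_le.1 fun h' => hsil _ ⟨Nat.find_spec hex, h'⟩
  have hdisj : Pairwise (Function.onFun (AEDisjoint gapLaw) (D 0)) := by
    have : ∀ i j, i < j → AEDisjoint gapLaw (D 0 i) (D 0 j) := by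
      intro i j hij
      have : ∀ᵐ g ∂gapLaw, g ∉ D 0 i ∩ D 0 j := by
        filter_upwards [ae_gapLaw_pos] with g hg hmem
        have h1 := hmem.1.2
        rw [← Finset.sum_range_succ, add_zero] at h1
        have h2 := hmem.2.1
        have := Finset.sum_le_sum_of_subset_of_nonneg (f := g)
          (Finset.range_subset_range.2 (Nat.succ_le_of_lt hij)) fun k _ _ => (hg k).le
        exact not_lt.2 (this.trans h2) h1
      rw [ae_iff] at this
      simpa [AEDisjoint] using this
    intro i j hij
    rcases lt_or_gt_of_ne hij with h' | h'
    · exact this i j h'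
    · exact (this j i h').symm
  have hle : gapLaw (silent s u) ≤ ENNReal.ofReal (Real.exp (-u)) := by
    calc gapLaw (silent s u) ≤ gapLaw (⋃ n, D u n) := hcover
      _ ≤ ∑' n, gapLaw (D u n) := measure_iUnion_le _
      _ = ENNReal.ofReal (Real.exp (-u)) * ∑' n, gapLaw (D 0 n) := by
        simp only [hD, ENNReal.tsum_mul_left]
      _ ≤ ENNReal.ofReal (Real.exp (-u)) * gapLaw Set.univ := by
        gcongr
        exact tsum_meas_le_meas_iUnion_of_disjoint₀ _ (fun n => (hDm 0 n).nullMeasurableSet)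
          hdisj |>.trans (measure_mono (Set.subset_univ _))
      _ = ENNReal.ofReal (Real.exp (-u)) := by simp
  exact ENNReal.toReal_le_of_le_ofReal (Real.exp_pos _).le hle

/-! ### Spread of stable plus spins along a path -/

/-- The product over the sites of the laws of single clocks. -/
noncomputable def siteClockLaw : Measure (Site → ℕ → ℝ) := Measure.infinitePi fun _ => gapLaw

instance : IsProbabilityMeasure siteClockLaw := by unfold siteClockLaw; infer_instance

/-- A delay of `L` in the spread along the path `p (j - 1), …, p 0` that starts at time `s`.
The spread waits at each site for the next ring, and `w` is the number of full time units of
this wait: the next site starts at the integer time `s + w + 1`. -/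
def delayed (p : ℕ → Site) : ℕ → ℕ → ℕ → Set (Site → ℕ → ℝ)
  | 0, _, _ => ∅
  | j + 1, s, L => {K | K (p j) ∈ silent s L} ∪
      ⋃ w ∈ Finset.range L, {K | K (p j) ∈ silent s w} ∩ delayed p j (s + w + 1) (L - w)

theorem exp_neg_natCast_le (w : ℕ) : Real.exp (-(w : ℝ)) ≤ (3 / 8 : ℝ) ^ w := by
  have h1 : Real.exp (-1) ≤ 3 / 8 := by
    rw [Real.exp_neg, inv_le_comm₀ (Real.exp_pos _) (by norm_num)]
    linarith [Real.exp_one_gt_d9]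
  calc Real.exp (-(w : ℝ)) = Real.exp (-1) ^ w := by rw [← Real.exp_nat_mul]; ring_nf
    _ ≤ _ := pow_le_pow_left₀ (Real.exp_pos _).le h1 w

/-- Union bound over the waiting times. The event `Set.pi I S`, which concerns clocks of other sites,
is what makes the induction work. -/
theorem siteClockLaw_inter_delayed_le {p : ℕ → Site} (hp : Function.Injective p) (j : ℕ) :
    ∀ (s L : ℕ) (I : Finset Site) (S : Site → Set (ℕ → ℝ)), (∀ x, MeasurableSet (S x)) →
      (∀ i < j, p i ∉ I) →
      siteClockLaw.real (Set.pi (I : Set Site) S ∩ delayed p j s L) ≤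
        siteClockLaw.real (Set.pi (I : Set Site) S) * (3 ^ j * (3 / 4) ^ L) := by
  classical
  induction j with
  | zero =>
    intro s L I S _ _
    simp only [delayed, Set.inter_empty, measureReal_empty]
    positivity
  | succ j IH =>
    intro s L I S hS hI
    set b := siteClockLaw.real (Set.pi (I : Set Site) S) with hb
    have hb0 : 0 ≤ b := measureReal_nonneg
    have hpj : p j ∉ I := hI j (Nat.lt_succ_self j)
    -- the constraint on the clock at `p j` turns a box into a box
    have hbox : ∀ w : ℕ, Set.pi (I : Set Site) S ∩ {K | K (p j) ∈ silent s w} =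
        Set.pi (insert (p j) I : Finset Site) (Function.update S (p j) (silent s w)) := by
      intro w
      rw [Finset.coe_insert, Set.insert_pi, Function.update_self, Set.inter_comm]
      congr 1
      refine Set.pi_congr rfl fun i hi => ?_
      rw [Function.update_of_ne]
      rintro rfl
      exact hpj hi
    have hmeasS : ∀ (w : ℕ) (x : Site),
        MeasurableSet (Function.update S (p j) (silent s w) x) := by
      intro w x
      by_cases hx : x = p j
      · rw [hx, Function.update_self]; exact measurableSet_silent _ _
      · rw [Function.update_of_ne hx]; exact hS x
    have hboxle : ∀ w : ℕ,
        siteClockLaw.real (Set.pi (I : Set Site) S ∩ {K | K (p j) ∈ silent s w}) ≤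
          b * (3 / 8) ^ w := by
      intro w
      have h1 : siteClockLaw (Set.pi (I : Set Site) S ∩ {K | K (p j) ∈ silent s w}) =
          siteClockLaw (Set.pi (I : Set Site) S) * gapLaw (silent s w) := by
        rw [hbox w, siteClockLaw, Measure.infinitePi_pi _ fun x _ => hmeasS w x,
          Measure.infinitePi_pi _ fun x _ => hS x, Finset.prod_insert hpj, Function.update_self,
          mul_comm]
        congr 1
        refine Finset.prod_congr rfl fun i hi => ?_
        rw [Function.update_of_ne]
        rintro rfl
        exact hpj hi
      rw [measureReal_def, h1, ENNReal.toReal_mul]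
      exact mul_le_mul_of_nonneg_left
        ((gapLaw_silent_le (Nat.cast_nonneg s) (Nat.cast_nonneg w)).trans
          (exp_neg_natCast_le w)) hb0
    have hstep : ∀ w : ℕ, w < L → siteClockLaw.real (Set.pi (I : Set Site) S ∩
        ({K | K (p j) ∈ silent s w} ∩ delayed p j (s + w + 1) (L - w))) ≤
          b * (3 ^ j * (3 / 4) ^ L) * (1 / 2) ^ w := by
      intro w hw
      rw [← Set.inter_assoc, hbox w]
      refine (IH (s + w + 1) (L - w) _ _ (hmeasS w) ?_).trans ?_
      · intro i hi
        rw [Finset.mem_insert, not_or]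
        exact ⟨fun h' => hi.ne (hp h'), hI i (hi.trans (Nat.lt_succ_self j))⟩
      · rw [← hbox w]
        calc _ ≤ b * (3 / 8) ^ w * (3 ^ j * (3 / 4 : ℝ) ^ (L - w)) := by
              gcongr
              exact hboxle w
          _ = b * (3 ^ j * ((3 / 4) ^ (L - w) * (3 / 4) ^ w)) * (1 / 2) ^ w := by
              rw [show (3 / 8 : ℝ) = 3 / 4 * (1 / 2) by norm_num, mul_pow]; ring
          _ = _ := by rw [← pow_add, Nat.sub_add_cancel hw.le]
    have hsum : ∑ w ∈ Finset.range L, (1 / 2 : ℝ) ^ w ≤ 2 := by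
      have h1 := geom_sum_mul_neg (1 / 2 : ℝ) L
      have h2 : (0 : ℝ) ≤ (1 / 2) ^ L := by positivity
      linarith
    have hset : Set.pi (I : Set Site) S ∩ delayed p (j + 1) s L =
        (Set.pi (I : Set Site) S ∩ {K | K (p j) ∈ silent s L}) ∪
        ⋃ w ∈ Finset.range L, Set.pi (I : Set Site) S ∩
          ({K | K (p j) ∈ silent s w} ∩ delayed p j (s + w + 1) (L - w)) := by
      rw [delayed, Set.inter_union_distrib_left, Set.inter_iUnion₂]
    have hpow : (3 / 8 : ℝ) ^ L ≤ 3 ^ j * (3 / 4) ^ L :=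
      (pow_le_pow_left₀ (by norm_num) (by norm_num) L).trans
        (le_mul_of_one_le_left (by positivity) (one_le_pow₀ (by norm_num)))
    rw [hset]
    calc _ ≤ b * (3 / 8) ^ L + ∑ w ∈ Finset.range L, b * (3 ^ j * (3 / 4) ^ L) * (1 / 2) ^ w :=
          (measureReal_union_le _ _).trans (add_le_add (hboxle L)
            ((measureReal_biUnion_finset_le _ _).trans
              (Finset.sum_le_sum fun w hw => hstep w (Finset.mem_range.1 hw))))
      _ ≤ b * (3 ^ j * (3 / 4) ^ L) + b * (3 ^ j * (3 / 4) ^ L) * 2 := by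
          rw [← Finset.mul_sum]
          gcongr
      _ = _ := by ring

theorem siteClockLaw_delayed_le {p : ℕ → Site} (hp : Function.Injective p) (j s L : ℕ) :
    siteClockLaw.real (delayed p j s L) ≤ 3 ^ j * (3 / 4) ^ L := by
  simpa using siteClockLaw_inter_delayed_le hp j s L ∅ (fun _ => Set.univ) (by simp) (by simp)

/-- Without delay, stability of the last site of the path is passed on to the first one. -/
theorem IsTrajectory.stablePlus_of_not_delayed {h : ℝ} {ω : Env} {σ : ℝ → Config}
    (hσ : IsTrajectory h ω σ) (hω : ω.Regular) (hh : 2 ≤ h) {p : ℕ → Site}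
    (hp : ∀ j, hexLattice.Adj (p j) (p (j + 1))) (j : ℕ) :
    ∀ s L : ℕ, StablePlus σ (p j) s → ω.gap ∉ delayed p j s L →
      StablePlus σ (p 0) (s + j + L) := by
  classical
  induction j with
  | zero => exact fun s L hs _ => hs.mono (by simp)
  | succ j IH =>
    intro s L hs hd
    simp only [delayed, Set.mem_union, Set.mem_iUnion, not_or, not_exists, Finset.mem_range,
      Set.mem_inter_iff, not_and, Set.mem_ofPred_eq] at hd
    obtain ⟨hd1, hd2⟩ := hd
    have hex : ∃ w : ℕ, ω.gap (p j) ∉ silent s w := ⟨L, hd1⟩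
    obtain ⟨w, hw⟩ : ∃ w, Nat.find hex = w + 1 := by
      refine Nat.exists_eq_succ_of_ne_zero fun h0 => ?_
      have := Nat.find_spec hex
      rw [h0] at this
      simp [silent] at this
    have hwL : w < L := by
      have := Nat.find_min' hex hd1
      omega
    have hsil : ω.gap (p j) ∈ silent s w := not_not.1 (Nat.find_min hex (by omega))
    have hring := Nat.find_spec hex
    rw [hw] at hring
    simp only [silent, Set.mem_ofPred_eq, not_forall, not_not] at hring
    obtain ⟨n, hn⟩ := hring
    have hstab := (hσ.stablePlus_of_ring hω hh (hp j) hs (n := n) hn.1).mono hn.2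
    have := IH (s + w + 1) (L - w) (by push_cast at hstab ⊢; rwa [add_assoc]) (hd2 w hwL hsil)
    refine this.mono (le_of_eq ?_)
    push_cast [Nat.cast_sub hwL.le]
    ring

/-! ### Almost sure regularity of the environment -/

theorem measurePreserving_gap (lam : unitInterval) (ν : Measure ℝ) [IsProbabilityMeasure ν] :
    MeasurePreserving Env.gap (envLaw lam ν) siteClockLaw := by
  have h1 : MeasurePreserving (fun ω : Env => ω.2.1.1) (envLaw lam ν)
      (Measure.infinitePi fun _ => expMeasure 1) :=
    measurePreserving_fst.comp (measurePreserving_fst.comp measurePreserving_snd)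
  have h2 : MeasurePreserving (MeasurableEquiv.curry Site ℕ ℝ)
      (Measure.infinitePi fun _ => expMeasure 1) siteClockLaw :=
    ⟨(MeasurableEquiv.curry Site ℕ ℝ).measurable,
      Measure.infinitePi_map_curry fun _ _ => expMeasure 1⟩
  exact h2.comp h1

theorem envLaw_gap_delayed_le (lam : unitInterval) (ν : Measure ℝ) [IsProbabilityMeasure ν]
    {p : ℕ → Site} (hp : Function.Injective p) (j s L : ℕ) :
    (envLaw lam ν).real (Env.gap ⁻¹' delayed p j s L) ≤ 3 ^ j * (3 / 4) ^ L := by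
  have hmp := measurePreserving_gap lam ν
  refine le_trans ?_ (siteClockLaw_delayed_le hp j s L)
  rw [measureReal_def, measureReal_def, ← hmp.map_eq]
  exact ENNReal.toReal_mono (by rw [hmp.map_eq]; exact measure_ne_top _ _)
    (Measure.le_map_apply hmp.aemeasurable _)

theorem ae_regular (lam : unitInterval) (ν : Measure ℝ) [IsProbabilityMeasure ν]
    (hν : ∀ᵐ j ∂ν, j ∈ Set.Ico (0 : ℝ) 1) : ∀ᵐ ω ∂(envLaw lam ν), ω.Regular := by
  have hclock : ∀ {q : (ℕ → ℝ) → Prop}, (∀ᵐ g ∂gapLaw, q g) →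
      ∀ᵐ ω ∂(envLaw lam ν), ∀ x, q (ω.gap x) := fun hq =>
    ae_all_iff.2 fun x => ((measurePreserving_eval_infinitePi (fun _ : Site => gapLaw) x).comp
      (measurePreserving_gap lam ν)).quasiMeasurePreserving.ae hq
  have hJ : ∀ᵐ ω ∂(envLaw lam ν), ∀ e, ω.couplings e ∈ Set.Ico (0 : ℝ) 1 :=
    ae_all_iff.2 fun e => ((measurePreserving_eval_infinitePi (fun _ => ν) e).comp
      ((measurePreserving_snd (μ := clockLaw) (ν := couplingLaw ν)).comp
        (measurePreserving_snd (μ := initialLaw lam)))).quasiMeasurePreserving.ae hν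
  filter_upwards [hclock ae_gapLaw_pos, hclock ae_gapLaw_tendsto, hJ] with ω h1 h2 h3
  exact ⟨h1, h2, h3⟩

/-! ### Seeds along a zigzag path -/

/-- The zigzag path `(0, 0, false), (0, 0, true), (1, 0, false), (1, 0, true), …` -/
def zigzag (j : ℕ) : Site := ((j / 2 : ℕ), 0, decide (j % 2 = 1))

theorem zigzag_zero : zigzag 0 = origin := rfl

theorem zigzag_two_mul (k : ℕ) : zigzag (2 * k) = ((k : ℤ), 0, false) := by
  simp [zigzag]

theorem zigzag_injective : Function.Injective zigzag := by
  intro i j hij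
  simp only [zigzag, Prod.mk.injEq, Nat.cast_inj, true_and, decide_eq_decide] at hij
  omega

theorem adj_zigzag (j : ℕ) : hexLattice.Adj (zigzag j) (zigzag (j + 1)) := by
  rcases Nat.even_or_odd' j with ⟨k, rfl | rfl⟩
  · refine ⟨0, ?_⟩
    rw [zigzag_two_mul]
    have : (2 * k + 1) / 2 = k := by omega
    simp [zigzag, nbr, this]
  · refine ⟨1, ?_⟩
    have : (2 * k + 1) / 2 = k := by omega
    rw [show 2 * k + 1 + 1 = 2 * (k + 1) by ring, zigzag_two_mul]
    simp [zigzag, nbr, this]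

/-- The origin is not stably plus from time `t` on, for some trajectory. -/
def unstable (h t : ℝ) : Set Env :=
  {ω | ω.Regular ∧ ∃ σ, IsTrajectory h ω σ ∧ ¬ StablePlus σ origin t}

theorem unstable_anti (h : ℝ) : Antitone (unstable h) := fun _ _ hst _ ⟨hω, σ, hσ, hn⟩ =>
  ⟨hω, σ, hσ, fun h' => hn (h'.mono hst)⟩

/-- The site in cell `(k, 0)` at which seeds are sought; it is the `2 k`-th site of the zigzag path. -/
abbrev seedSite (k : ℕ) : Site := ((k : ℤ), 0, false)

/-- The partner of `seedSite k` in cell `(k, 0)`. -/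
abbrev partner (k : ℕ) : Site := ((k : ℤ), 0, true)

theorem adj_partner (k : ℕ) : hexLattice.Adj (partner k) (seedSite k) := ⟨0, by simp [nbr]⟩

/-- If independent events of probability at least `q` each create a stable plus spin at the even sites
of the path by time `1`, then the origin becomes stable exponentially fast: either none of the
first `n` events occurs, or the spread from one of these seeds is delayed. -/
theorem envLaw_unstable_le {lam : unitInterval} {ν : Measure ℝ} [IsProbabilityMeasure ν]
    {h : ℝ} (hh : 2 ≤ h) {A : ℕ → Set Env} (hA : iIndepSet A (envLaw lam ν))
    (hAm : ∀ k, MeasurableSet (A k)) {q : ℝ} (hq : ∀ k, q ≤ (envLaw lam ν).real (A k))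
    (hstab : ∀ k, ∀ ω ∈ A k, ω.Regular → ∀ σ, IsTrajectory h ω σ → StablePlus σ (seedSite k) 1)
    (n : ℕ) :
    (envLaw lam ν).real (unstable h (10 * n + 1)) ≤ (1 - q) ^ n + (10 / 11) ^ n := by
  have hsub : unstable h (10 * n + 1) ⊆ (⋂ k ∈ Finset.range n, (A k)ᶜ) ∪
      ⋃ k ∈ Finset.range n, Env.gap ⁻¹' delayed zigzag (2 * k) 1 (8 * n) := by
    rintro ω ⟨hω, σ, hσ, hn⟩
    by_contra hc
    simp only [Set.mem_union, Set.mem_iInter, Set.mem_iUnion, not_or, not_exists, not_forall,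
      Set.mem_compl_iff, not_not, Finset.mem_range] at hc
    obtain ⟨⟨k, hk, hkA⟩, hd⟩ := hc
    refine hn ?_
    have h1 : StablePlus σ (zigzag (2 * k)) ((1 : ℕ) : ℝ) := by
      rw [zigzag_two_mul, Nat.cast_one]
      exact hstab k ω hkA hω σ hσ
    rw [← zigzag_zero]
    refine (hσ.stablePlus_of_not_delayed hω hh adj_zigzag (2 * k) 1 (8 * n) h1 (hd k hk)).mono ?_
    have : (k : ℝ) ≤ n := by exact_mod_cast hk.le
    push_cast
    linarith
  have h1 : (envLaw lam ν).real (⋂ k ∈ Finset.range n, (A k)ᶜ) ≤ (1 - q) ^ n := by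
    rw [measureReal_biInter_compl hA hAm]
    calc _ ≤ ∏ _k ∈ Finset.range n, (1 - q) := Finset.prod_le_prod
          (fun k _ => sub_nonneg.2 measureReal_le_one) fun k _ => sub_le_sub_left (hq k) 1
      _ = _ := by simp
  have hgeom : ∀ n : ℕ, ∑ k ∈ Finset.range n, (9 : ℝ) ^ k ≤ 9 ^ n := by
    intro n
    have := geom_sum_mul (9 : ℝ) n
    have h9 : (0 : ℝ) ≤ ∑ k ∈ Finset.range n, (9 : ℝ) ^ k :=
      Finset.sum_nonneg fun _ _ => by positivity
    linarith
  have h2 : (envLaw lam ν).real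
      (⋃ k ∈ Finset.range n, Env.gap ⁻¹' delayed zigzag (2 * k) 1 (8 * n)) ≤ (10 / 11) ^ n := by
    calc _ ≤ ∑ k ∈ Finset.range n, (3 : ℝ) ^ (2 * k) * (3 / 4) ^ (8 * n) :=
          (measureReal_biUnion_finset_le _ _).trans (Finset.sum_le_sum fun k _ =>
            envLaw_gap_delayed_le lam ν zigzag_injective (2 * k) 1 (8 * n))
      _ = (∑ k ∈ Finset.range n, (9 : ℝ) ^ k) * ((3 / 4) ^ 8) ^ n := by
          rw [Finset.sum_mul]
          refine Finset.sum_congr rfl fun k _ => ?_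
          rw [pow_mul, pow_mul]; norm_num
      _ ≤ 9 ^ n * ((3 / 4) ^ 8) ^ n := by gcongr; exact hgeom n
      _ = (9 * (3 / 4) ^ 8) ^ n := by rw [mul_pow]
      -- the length `8 n` of the delay is chosen such that `9 * (3 / 4) ^ 8 < 1`
      _ ≤ _ := pow_le_pow_left₀ (by norm_num) (by norm_num) n
  exact (measureReal_mono hsub).trans ((measureReal_union_le _ _).trans (add_le_add h1 h2))

/-! ### Seeds in the initial configuration -/

instance : MeasurableSingletonClass ℤˣ where
  measurableSet_singleton u := by
    have : ({u} : Set ℤˣ) = Units.val ⁻¹' {(u : ℤ)} := by ext; simp [Units.ext_iff]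
    rw [this]
    exact ⟨_, measurableSet_singleton _, rfl⟩

/-- Both spins of cell `(k, 0)` are plus initially. -/
def plusPair (k : ℕ) : Set Env :=
  (Set.pi (({seedSite k, partner k} : Finset Site) : Set Site) fun _ => {(1 : ℤˣ)}) ×ˢ Set.univ

theorem measurableSet_plusPair (k : ℕ) : MeasurableSet (plusPair k) :=
  (MeasurableSet.pi (Finset.countable_toSet _) fun _ _ => measurableSet_singleton _).prod .univ

theorem iIndepSet_plusPair (lam : unitInterval) (ν : Measure ℝ) [IsProbabilityMeasure ν] :
    iIndepSet plusPair (envLaw lam ν) := by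
  refine iIndepSet_prod (iIndepSet_pi _ ?_ fun _ => measurableSet_singleton _) iIndepSet_univ
    (fun k => .pi (Finset.countable_toSet _) fun _ _ => measurableSet_singleton _) fun _ => .univ
  intro i j hij
  simp [Function.onFun, hij.symm]

theorem envLaw_plusPair (lam : unitInterval) (ν : Measure ℝ) [IsProbabilityMeasure ν] (k : ℕ) :
    (envLaw lam ν).real (plusPair k) = (lam : ℝ) ^ 2 := by
  rw [plusPair, envLaw, measureReal_prod_prod, probReal_univ, mul_one, initialLaw, measureReal_def,
    Measure.infinitePi_pi _ fun _ _ => measurableSet_singleton _, ENNReal.toReal_prod,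
    Finset.prod_pair (by simp), ← measureReal_def,
    bernoulliMeasure_real_apply_of_mem_of_notMem _ (measurableSet_singleton _) (by simp)
      (by simp)]
  exact (sq _).symm

theorem stablePlus_of_plusPair {h : ℝ} (hh : 2 ≤ h) {k : ℕ} {ω : Env} (hk : ω ∈ plusPair k)
    (hω : ω.Regular) {σ : ℝ → Config} (hσ : IsTrajectory h ω σ) : StablePlus σ (seedSite k) 0 := by
  have h1 : ∀ x ∈ ({seedSite k, partner k} : Finset Site), ω.init x = 1 := fun x hx => hk.1 x hx
  refine (hσ.stablePlus_pair hω hh (adj_partner k) le_rfl ?_ ?_).2 <;> rw [hσ.initial]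
  · exact h1 _ (by simp)
  · exact h1 _ (by simp)

/-! ### Seeds created by the dynamics -/

/-- The three edges at a site, which index the couplings there. -/
def edgesAt (x : Site) : Finset hexLattice.edgeSet := by
  classical exact Finset.univ.image fun i => ⟨s(x, nbr x i), adj_nbr x i⟩

theorem card_edgesAt (x : Site) : (edgesAt x).card = 3 := by
  classical
  rw [edgesAt, Finset.card_image_of_injective, Finset.card_univ, Fintype.card_fin]
  intro i j hij
  exact nbr_injective x (Sym2.congr_right.1 (congrArg Subtype.val hij))

/-- Windows for the gaps in a nucleation event: the first ring of the seed site is not later than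
`t`, its second gap is longer than `2`, the first ring of the partner is in `(1, 2]`. -/
def gapWindow (t : ℝ) (p : Site × ℕ) : Set ℝ :=
  if p.1.2.2 then Set.Ioc 1 2 else if p.2 = 0 then Set.Iic t else Set.Ioi 2

theorem measurableSet_gapWindow (t : ℝ) (p : Site × ℕ) : MeasurableSet (gapWindow t p) := by
  unfold gapWindow
  split_ifs
  exacts [measurableSet_Ioc, measurableSet_Iic, measurableSet_Ioi]

/-- The gaps that matter for nucleation in cell `(k, 0)`. -/
abbrev gapIndices (k : ℕ) : Finset (Site × ℕ) :=
  {(seedSite k, 0), (seedSite k, 1), (partner k, 0)}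

/-- The nucleation event in cell `(k, 0)`: the seed site is minus initially, its couplings are at most
`h / 3`, the coin of its first ring shows heads, and the gaps lie in the windows `gapWindow t`. Then
it turns into a stable plus spin at its first ring, which is not later than `t ≤ 1`. -/
def nucleation (h t : ℝ) (k : ℕ) : Set Env :=
  Set.pi (({seedSite k} : Finset Site) : Set Site) (fun _ => {(-1 : ℤˣ)}) ×ˢ
    ((Set.pi (gapIndices k : Set (Site × ℕ)) (gapWindow t) ×ˢ
        Set.pi (({(seedSite k, 0)} : Finset (Site × ℕ)) : Set (Site × ℕ)) fun _ => {true}) ×ˢ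
      Set.pi (edgesAt (seedSite k) : Set hexLattice.edgeSet) fun _ => Set.Iic (h / 3))

theorem measurableSet_pi_finset {ι : Type*} {X : ι → Type*} [∀ i, MeasurableSpace (X i)]
    (I : Finset ι) {t : ∀ i, Set (X i)} (ht : ∀ i, MeasurableSet (t i)) :
    MeasurableSet (Set.pi (I : Set ι) t) := .pi I.countable_toSet fun i _ => ht i

theorem measurableSet_nucleation (h t : ℝ) (k : ℕ) : MeasurableSet (nucleation h t k) :=
  (measurableSet_pi_finset _ fun _ => measurableSet_singleton _).prod
    (((measurableSet_pi_finset _ (measurableSet_gapWindow t)).prod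
      (measurableSet_pi_finset _ fun _ => measurableSet_singleton _)).prod
      (measurableSet_pi_finset _ fun _ => measurableSet_Iic))

theorem iIndepSet_nucleation (lam : unitInterval) (ν : Measure ℝ) [IsProbabilityMeasure ν]
    (h t : ℝ) : iIndepSet (nucleation h t) (envLaw lam ν) := by
  classical
  refine iIndepSet_prod (iIndepSet_pi _ ?_ fun _ => measurableSet_singleton _)
    (iIndepSet_prod (iIndepSet_prod (iIndepSet_pi _ ?_ (measurableSet_gapWindow t))
        (iIndepSet_pi _ ?_ fun _ => measurableSet_singleton _)
        (fun k => measurableSet_pi_finset _ (measurableSet_gapWindow t))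
        fun k => measurableSet_pi_finset _ fun _ => measurableSet_singleton _)
      (iIndepSet_pi _ ?_ fun _ => measurableSet_Iic)
      (fun k => (measurableSet_pi_finset _ (measurableSet_gapWindow t)).prod
        (measurableSet_pi_finset _ fun _ => measurableSet_singleton _))
      fun k => measurableSet_pi_finset _ fun _ => measurableSet_Iic)
    (fun k => measurableSet_pi_finset _ fun _ => measurableSet_singleton _)
    fun k => ((measurableSet_pi_finset _ (measurableSet_gapWindow t)).prod
      (measurableSet_pi_finset _ fun _ => measurableSet_singleton _)).prod
      (measurableSet_pi_finset _ fun _ => measurableSet_Iic)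
  · intro i j hij
    simp [Function.onFun, hij]
  · intro i j hij
    simp [Function.onFun, hij.symm]
  · intro i j hij
    simp [Function.onFun, hij]
  · intro i j hij
    -- an edge has only one endpoint in the sublattice of the seed sites
    rw [Function.onFun, Finset.disjoint_left]
    intro e hi hj
    simp only [edgesAt, Finset.mem_image, Finset.mem_univ, true_and] at hi hj
    obtain ⟨a, rfl⟩ := hi
    obtain ⟨b, hb⟩ := hj
    rcases Sym2.eq_iff.1 (congrArg Subtype.val hb) with hb | hb
    · simp only [Prod.mk.injEq, Nat.cast_inj] at hb
      exact hij hb.1.1.symm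
    · simp [nbr] at hb

theorem envLaw_nucleation (lam : unitInterval) (ν : Measure ℝ) [IsProbabilityMeasure ν]
    (h : ℝ) {t : ℝ} (ht : 0 ≤ t) (k : ℕ) :
    (envLaw lam ν).real (nucleation h t k) =
      (1 - lam) * ((1 - Real.exp (-t)) * (Real.exp (-2) * (Real.exp (-1) - Real.exp (-2))) *
        (1 / 2) * ν.real (Set.Iic (h / 3)) ^ 3) := by
  have h1 : (initialLaw lam).real
      (Set.pi (({seedSite k} : Finset Site) : Set Site) (fun _ => {(-1 : ℤˣ)})) = 1 - lam := by
    rw [initialLaw, measureReal_def, Measure.infinitePi_pi _ fun _ _ => measurableSet_singleton _,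
      Finset.prod_singleton, ← measureReal_def,
      bernoulliMeasure_real_apply_of_notMem_of_mem _ (measurableSet_singleton _)
        (by simp) (by simp)]
  have h2 : (Measure.infinitePi fun _ : Site × ℕ => expMeasure 1).real
      (Set.pi (gapIndices k : Set (Site × ℕ)) (gapWindow t)) =
      (1 - Real.exp (-t)) * (Real.exp (-2) * (Real.exp (-1) - Real.exp (-2))) := by
    have hIoc : (expMeasure 1).real (Set.Ioc 1 2) = Real.exp (-1) - Real.exp (-2) := by
      rw [← Set.Iic_sdiff_Iic,
        measureReal_sdiff (Set.Iic_subset_Iic.2 one_le_two) measurableSet_Iic,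
        expMeasure_Iic zero_le_two, expMeasure_Iic zero_le_one]
      ring
    have hIoi : (expMeasure 1).real (Set.Ioi 2) = Real.exp (-2) := by
      rw [measureReal_def, expMeasure_Ioi zero_le_two, ENNReal.toReal_ofReal (Real.exp_pos _).le]
    rw [measureReal_def, Measure.infinitePi_pi _ fun p _ => measurableSet_gapWindow t p,
      ENNReal.toReal_prod, Finset.prod_insert (by simp), Finset.prod_pair (by simp)]
    simp only [← measureReal_def, gapWindow, Bool.false_eq_true, if_false, if_true, one_ne_zero]
    rw [hIoc, hIoi, expMeasure_Iic ht]
  have h3 : (Measure.infinitePi fun _ : Site × ℕ => uniformOn (Set.univ : Set Bool)).real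
      (Set.pi (({(seedSite k, 0)} : Finset (Site × ℕ)) : Set (Site × ℕ)) fun _ => {true}) =
      1 / 2 := by
    rw [measureReal_def, Measure.infinitePi_pi _ fun _ _ => measurableSet_singleton _,
      Finset.prod_singleton, uniformOn_univ]
    simp
  have h4 : (couplingLaw ν).real
      (Set.pi (edgesAt (seedSite k) : Set hexLattice.edgeSet) fun _ => Set.Iic (h / 3)) =
      ν.real (Set.Iic (h / 3)) ^ 3 := by
    rw [couplingLaw, measureReal_def, Measure.infinitePi_pi _ fun _ _ => measurableSet_Iic,
      ENNReal.toReal_prod, Finset.prod_const, card_edgesAt, measureReal_def]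
  rw [nucleation, envLaw, clockLaw, measureReal_prod_prod, measureReal_prod_prod,
    measureReal_prod_prod, h1, h2, h3, h4]

theorem stablePlus_of_mem_nucleation {h : ℝ} (hh : 2 ≤ h) {t : ℝ} (ht : t ≤ 1) {k : ℕ} {ω : Env}
    (hk : ω ∈ nucleation h t k) (hω : ω.Regular) {σ : ℝ → Config} (hσ : IsTrajectory h ω σ) :
    StablePlus σ (seedSite k) t := by
  classical
  obtain ⟨hinit, ⟨hgap, hcoin⟩, hJ⟩ := hk
  have hx0 : ω.gap (seedSite k) 0 ≤ t := by
    have := hgap (seedSite k, 0) (by simp)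
    simp only [gapWindow, Bool.false_eq_true, if_false, if_true] at this
    exact this
  have hx1 : 2 < ω.gap (seedSite k) 1 := by
    have := hgap (seedSite k, 1) (by simp)
    simp only [gapWindow, Bool.false_eq_true, if_false, one_ne_zero] at this
    exact this
  have hy : ω.gap (partner k) 0 ∈ Set.Ioc (1 : ℝ) 2 := by
    have := hgap (partner k, 0) (by simp)
    simp only [gapWindow, if_true] at this
    exact this
  refine (hσ.stablePlus_of_nucleation hω hh (adj_partner k) ?_ (fun i => ?_) ?_
    (hx0.trans ht) hx1 hy).mono hx0
  · exact hinit (seedSite k) (by simp)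
  · exact hJ _ (Finset.mem_coe.2 (Finset.mem_image_of_mem _ (Finset.mem_univ i)))
  · exact hcoin (seedSite k, 0) (by simp)

/-! ### Exponential decay -/

/-- Geometric decay up to a constant factor, together with a bound near `t = 0` that has the right
value at `0`, removes the constant. -/
theorem exists_exp_bound {f : ℝ → ℝ} (hf : Antitone f) {ρ a : ℝ} (hρ0 : 0 < ρ) (hρ1 : ρ < 1)
    (ha : 0 < a) (hlarge : ∀ n : ℕ, f (10 * n + 1) ≤ 2 * ρ ^ n)
    (hsmall : ∀ t, 0 ≤ t → t ≤ 1 → f t ≤ Real.exp (-(a * t))) :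
    ∃ c : ℝ, 0 < c ∧ ∀ t, 0 ≤ t → f t ≤ Real.exp (-(c * t)) := by
  set b := -Real.log ρ with hb
  have hb0 : 0 < b := by have := Real.log_neg hρ0 hρ1; linarith
  have hρ : ρ = Real.exp (-b) := by rw [hb, neg_neg, Real.exp_log hρ0]
  -- from time `T` on, half of the exponential rate pays for the constant factor
  set T := 20 * (1 + 2 * b) / b with hT
  have hTb : T * b = 20 * (1 + 2 * b) := by rw [hT]; field_simp
  have hT1 : 1 ≤ T := by
    rw [hT, le_div_iff₀ hb0]; linarith
  have hT0 : 0 < T := zero_lt_one.trans_le hT1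
  refine ⟨min (a / T) (b / 20), lt_min (by positivity) (by positivity), fun t ht => ?_⟩
  have hc1 : min (a / T) (b / 20) ≤ a / T := min_le_left _ _
  have hc2 : min (a / T) (b / 20) ≤ b / 20 := min_le_right _ _
  generalize min (a / T) (b / 20) = c at hc1 hc2
  have hcT : c * T ≤ a := (le_div_iff₀ hT0).1 hc1
  rcases le_total t 1 with ht1 | ht1
  · refine (hsmall t ht ht1).trans (Real.exp_le_exp.2 (neg_le_neg ?_))
    refine mul_le_mul_of_nonneg_right (hc1.trans (div_le_self ha.le hT1)) ht
  rcases le_total t T with htT | htT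
  · refine (hf ht1).trans ((hsmall 1 zero_le_one le_rfl).trans
      (Real.exp_le_exp.2 (neg_le_neg ?_)))
    rw [mul_one]
    calc c * t ≤ a / T * t := mul_le_mul_of_nonneg_right hc1 ht
      _ ≤ a / T * T := mul_le_mul_of_nonneg_left htT (by positivity)
      _ = a := div_mul_cancel₀ a hT0.ne'
  · set n := ⌊(t - 1) / 10⌋₊ with hn
    have hn1 : (n : ℝ) ≤ (t - 1) / 10 := Nat.floor_le (by linarith)
    have hn2 : (t - 1) / 10 < n + 1 := Nat.lt_floor_add_one _
    have h2 : (2 : ℝ) ≤ Real.exp 1 := by linarith [Real.exp_one_gt_d9]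
    calc f t ≤ f (10 * n + 1) := hf (by linarith)
      _ ≤ 2 * ρ ^ n := hlarge n
      _ ≤ Real.exp 1 * Real.exp (-b) ^ n := by rw [hρ]; gcongr
      _ = Real.exp (1 - n * b) := by rw [← Real.exp_nat_mul, ← Real.exp_add]; ring_nf
      _ ≤ Real.exp (-(c * t)) := by
        refine Real.exp_le_exp.2 ?_
        have h3 : c * t ≤ b / 20 * t := mul_le_mul_of_nonneg_right hc2 ht
        have h4 : T * b ≤ t * b := mul_le_mul_of_nonneg_right htT hb0.le
        have h5 : (t - 1) / 10 * b ≤ (n + 1) * b := mul_le_mul_of_nonneg_right hn2.le hb0.le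
        linarith

/-- Exponential decay of the probability that the origin is unstable, from independent seeds and an
estimate for short times. -/
theorem exists_envLaw_unstable_le {lam : unitInterval} {ν : Measure ℝ} [IsProbabilityMeasure ν]
    {h : ℝ} (hh : 2 ≤ h) {A : ℕ → Set Env} (hA : iIndepSet A (envLaw lam ν))
    (hAm : ∀ k, MeasurableSet (A k)) {q : ℝ} (hq0 : 0 < q)
    (hq : ∀ k, q ≤ (envLaw lam ν).real (A k))
    (hstab : ∀ k, ∀ ω ∈ A k, ω.Regular → ∀ σ, IsTrajectory h ω σ → StablePlus σ (seedSite k) 1)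
    {a : ℝ} (ha : 0 < a)
    (hsmall : ∀ t, 0 ≤ t → t ≤ 1 →
      (envLaw lam ν).real (unstable h t) ≤ Real.exp (-(a * t))) :
    ∃ c : ℝ, 0 < c ∧ ∀ t, 0 ≤ t →
      (envLaw lam ν).real (unstable h t) ≤ Real.exp (-(c * t)) := by
  refine exists_exp_bound (ρ := max (1 - q) (10 / 11))
    (fun s t hst => measureReal_mono (unstable_anti h hst)) (lt_max_of_lt_right (by norm_num))
    (max_lt (by linarith) (by norm_num)) ha (fun n => ?_) hsmall
  have hq1 : q ≤ 1 := (hq 0).trans measureReal_le_one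
  have h1 : (1 - q) ^ n ≤ max (1 - q) (10 / 11) ^ n :=
    pow_le_pow_left₀ (by linarith) (le_max_left _ _) n
  have h2 : (10 / 11 : ℝ) ^ n ≤ max (1 - q) (10 / 11) ^ n :=
    pow_le_pow_left₀ (by norm_num) (le_max_right _ _) n
  linarith [envLaw_unstable_le hh hA hAm hq hstab n]

theorem envLaw_unstable_le_compl {lam : unitInterval} {ν : Measure ℝ} [IsProbabilityMeasure ν]
    {h t : ℝ} {A : Set Env} (hA : MeasurableSet A)
    (hstab : ∀ ω ∈ A, ω.Regular → ∀ σ, IsTrajectory h ω σ → StablePlus σ origin t) :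
    (envLaw lam ν).real (unstable h t) ≤ 1 - (envLaw lam ν).real A := by
  rw [← probReal_compl_eq_one_sub hA]
  exact measureReal_mono fun ω ⟨hω, σ, hσ, hn⟩ hmem => hn (hstab ω hmem hω σ hσ)

theorem exists_envLaw_unstable_le_exp (ν : Measure ℝ) [IsProbabilityMeasure ν] {h : ℝ}
    (hh : 2 ≤ h) (lam : unitInterval) (hpos : 0 < (lam : ℝ) ∨ 0 < ν (Set.Iic (h / 3))) :
    ∃ c : ℝ, 0 < c ∧ ∀ t, 0 ≤ t →
      (envLaw lam ν).real (unstable h t) ≤ Real.exp (-(c * t)) := by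
  by_cases hlam : 0 < (lam : ℝ)
  · have hq : 0 < (lam : ℝ) ^ 2 := by positivity
    refine exists_envLaw_unstable_le hh (iIndepSet_plusPair lam ν) measurableSet_plusPair hq
      (fun k => (envLaw_plusPair lam ν k).ge)
      (fun k ω hk hω σ hσ => (stablePlus_of_plusPair hh hk hω hσ).mono zero_le_one) hq ?_
    intro t ht ht1
    calc (envLaw lam ν).real (unstable h t) ≤ 1 - (envLaw lam ν).real (plusPair 0) :=
          envLaw_unstable_le_compl (measurableSet_plusPair 0) fun ω hk hω σ hσ =>
            (stablePlus_of_plusPair hh hk hω hσ).mono ht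
      _ = 1 - (lam : ℝ) ^ 2 := by rw [envLaw_plusPair]
      _ ≤ Real.exp (-(lam : ℝ) ^ 2) := Real.one_sub_le_exp_neg _
      _ ≤ _ := Real.exp_le_exp.2 (neg_le_neg (mul_le_of_le_one_right hq.le ht1))
  · have hlam0 : (lam : ℝ) = 0 := le_antisymm (not_lt.1 hlam) lam.2.1
    have hν0 : 0 < ν.real (Set.Iic (h / 3)) :=
      ENNReal.toReal_pos (hpos.resolve_left hlam).ne' (measure_ne_top _ _)
    set κ := Real.exp (-2) * (Real.exp (-1) - Real.exp (-2)) * (1 / 2) *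
      ν.real (Set.Iic (h / 3)) ^ 3 with hκ
    have hκ0 : 0 < κ := by
      have : 0 < Real.exp (-1) - Real.exp (-2) :=
        sub_pos.2 (Real.exp_lt_exp.2 (by norm_num))
      positivity
    have hmeas : ∀ t, 0 ≤ t → ∀ k,
        (envLaw lam ν).real (nucleation h t k) = κ * (1 - Real.exp (-t)) := by
      intro t ht k
      rw [envLaw_nucleation lam ν h ht k, hlam0, hκ]
      ring
    have hlin : ∀ t : ℝ, 0 ≤ t → t ≤ 1 → t / 2 ≤ 1 - Real.exp (-t) := by
      intro t ht ht1
      have h1 : Real.exp (-t) * (1 + t) ≤ 1 := by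
        calc Real.exp (-t) * (1 + t) ≤ Real.exp (-t) * Real.exp t := by
              gcongr
              linarith [Real.add_one_le_exp t]
          _ = 1 := by rw [← Real.exp_add]; simp
      have h2 : Real.exp (-t) ≤ 1 - t / 2 := by
        refine le_of_mul_le_mul_right (h1.trans ?_) (by linarith : 0 < 1 + t)
        nlinarith
      linarith
    refine exists_envLaw_unstable_le hh (iIndepSet_nucleation lam ν h 1)
      (measurableSet_nucleation h 1) (q := κ * (1 - Real.exp (-1)))
      (mul_pos hκ0 (by linarith [hlin 1 zero_le_one le_rfl]))
      (fun k => (hmeas 1 zero_le_one k).ge)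
      (fun k ω hk hω σ hσ => stablePlus_of_mem_nucleation hh le_rfl hk hω hσ)
      (a := κ / 2) (by positivity) ?_
    intro t ht ht1
    calc (envLaw lam ν).real (unstable h t) ≤ 1 - (envLaw lam ν).real (nucleation h t 0) :=
          envLaw_unstable_le_compl (measurableSet_nucleation h t 0) fun ω hk hω σ hσ =>
            stablePlus_of_mem_nucleation hh ht1 hk hω hσ
      _ = 1 - κ * (1 - Real.exp (-t)) := by rw [hmeas t ht]
      _ ≤ 1 - κ / 2 * t := by
        have := mul_le_mul_of_nonneg_left (hlin t ht ht1) hκ0.le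
        linarith
      _ ≤ Real.exp (-(κ / 2 * t)) := Real.one_sub_le_exp_neg _

theorem flipProb_le {lam : unitInterval} {ν : Measure ℝ} [IsProbabilityMeasure ν]
    (hν : ∀ᵐ j ∂ν, j ∈ Set.Ico (0 : ℝ) 1) (h t : ℝ) :
    flipProb lam ν h t ≤ envLaw lam ν (unstable h t) := by
  refine measure_mono_ae ?_
  filter_upwards [ae_regular lam ν hν] with ω hω ⟨σ, hσ, hflip⟩
  exact ⟨hω, σ, hσ, fun hs => hs.not_flipsAfter hflip⟩

end ZeroTempIsing

theorem mainTheorem9 (ν : Measure ℝ) [IsProbabilityMeasure ν]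
    (hν : ∀ᵐ j ∂ν, j ∈ Set.Ico (0 : ℝ) 1)
    (h : ℝ) (hh : 2 ≤ h) (lam : unitInterval)
    (hpos : 0 < (lam : ℝ) ∨ 0 < ν (Set.Iic (h / 3))) :
    (∀ᵐ ω ∂(ZeroTempIsing.envLaw lam ν),
      (∃ σ, ZeroTempIsing.IsTrajectory h ω σ) ∧
      ∀ σ, ZeroTempIsing.IsTrajectory h ω σ →
        ∀ x, Tendsto (fun t => σ t x) atTop (𝓝 1)) ∧
    ∃ c : ℝ, 0 < c ∧ ∀ t : ℝ, 0 ≤ t →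
      ZeroTempIsing.flipProb lam ν h t ≤ ENNReal.ofReal (Real.exp (-(c * t))) := by
  obtain ⟨c, hc, hle⟩ := ZeroTempIsing.exists_envLaw_unstable_le_exp ν hh lam hpos
  refine ⟨?_, c, hc, fun t ht => (ZeroTempIsing.flipProb_le hν h t).trans ?_⟩
  · have hnull : ∀ᵐ ω ∂(ZeroTempIsing.envLaw lam ν),
        ω ∉ ⋂ n : ℕ, ZeroTempIsing.unstable h n := by
      rw [← measure_eq_zero_iff_ae_notMem, ← measureReal_eq_zero_iff]
      refine le_antisymm (ge_of_tendsto' (x := atTop) (f := fun n : ℕ => Real.exp (-(c * n)))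
        ?_ fun n => ?_) measureReal_nonneg
      · exact Real.tendsto_exp_neg_atTop_nhds_zero.comp
          (tendsto_natCast_atTop_atTop.const_mul_atTop hc)
      · exact (measureReal_mono (Set.iInter_subset _ n)).trans (hle n n.cast_nonneg)
    filter_upwards [ZeroTempIsing.ae_regular lam ν hν, hnull] with ω hω hn
    refine ⟨hω.exists_isTrajectory h, fun σ hσ x => ?_⟩
    simp only [Set.mem_iInter, not_forall] at hn
    obtain ⟨n, hn⟩ := hn
    have ho : ZeroTempIsing.StablePlus σ ZeroTempIsing.origin n := by
      by_contra hs
      exact hn ⟨hω, σ, hσ, hs⟩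
    obtain ⟨s, hs⟩ := hσ.exists_stablePlus hω hh ⟨_, ho⟩ x
    refine tendsto_const_nhds.congr' ?_
    filter_upwards [eventually_ge_atTop s] with t ht using (hs t ht).symm
  · rw [← ofReal_measureReal]
    exact ENNReal.ofReal_le_ofReal (hle t ht)
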